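/- Write $\log x=\max(1,\log_2 x)$. There are an absolute constant $C>0$, a constant integer $k\ge 1$ and a single decoding program $P$ for the word RAM with word size $w=k(\lfloor\log_2 n\rfloor+1)=\Theta(\log n)$ (unit-cost arithmetic, bitwise operations, comparisons and indirect memory access on $w$-bit words, and unit-cost access to up to $w$ consecutive bits of an input string) such that the following holds. Let $n\ge 1$ be an integer, let $T,\Delta$ be real numbers with $1\le T\le n$, and put $R=\frac{\log T}{\log\Delta}$. Let $G$ be a finite simple undirected graph with $n$ nodes, $m$ edges and average degree $\frac{2m}{n}\le\Delta$, in which every edge has a cost from $\{0,1\}$ (an unweighted graph is the case in which all costs are $1$), and let $\delta(u,v)$ be the cost of a cheapest path between $u$ and $v$, with $\delta(u,v)=\infty$ if there is none. Then every node $u$ of $G$ can be given a binary string $\mathrm{label}(u)$ of at most $C\,\frac{n}{R}\log R$ bits so that, for every pair of nodes $u,v$, the program $P$, given only $\mathrm{label}(u)$ and $\mathrm{label}(v)$, outputs exactly $\delta(u,v)$ after at most $C\,T$ steps. -/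

import Mathlib

/-! ### Logarithm convention and distances -/

/-- The logarithm convention `log x = max (1, log₂ x)`. -/
noncomputable def lg (x : ℝ) : ℝ := max 1 (Real.logb 2 x)

/-- The cost of a cheapest path between `u` and `v` in the graph `G` whose edge `e` costs `c e`;
it is `⊤` if `u` and `v` are in different connected components. As costs are nonnegative, walks
and paths give the same infimum. For the constant cost `1` this is the usual graph distance. -/
noncomputable def costDist {V : Type*} (G : SimpleGraph V) (c : Sym2 V → ℕ) (u v : V) : ℕ∞ :=
  ⨅ p : G.Walk u v, (((p.edges.map c).sum : ℕ) : ℕ∞)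

/-! ### The word RAM -/

namespace WordRAM

/-- Operands of instructions: a register, a literal constant, or the word size. -/
inductive Operand where
  | reg (r : ℕ)
  | lit (a : ℕ)
  | wordSize

/-- Arithmetic and bitwise operations on words. -/
inductive BinOp where
  | add | sub | mul | div | mod | and | or | xor | shl | shr

/-- Comparisons of words. -/
inductive Cmp where
  | eq | ne | lt | le

/-- Unit-cost instructions. -/
inductive Instr where
  /-- `dst := a` -/
  | mov (dst : ℕ) (a : Operand)
  /-- `dst := a op b` -/
  | op (o : BinOp) (dst : ℕ) (a b : Operand)
  /-- `dst := memory[a]` -/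
  | load (dst : ℕ) (a : Operand)
  /-- `memory[a] := b` -/
  | store (a b : Operand)
  /-- `dst :=` the `len` consecutive bits (at most one word) that start at position `pos` of the
  first (`which = false`) or second (`which = true`) input string. -/
  | read (dst : ℕ) (which : Bool) (pos len : Operand)

/-- Programs: finite objects, built from instructions by sequencing, branching and loops. -/
inductive Prog where
  | skip
  | instr (i : Instr)
  | seq (p q : Prog)
  | ite (t : Cmp) (a b : Operand) (p q : Prog)
  | while (t : Cmp) (a b : Operand) (p : Prog)

/-- A memory configuration: registers and random access memory, each cell holding one word.
A program mentions only finitely many registers. -/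
structure State where
  reg : ℕ → ℕ
  mem : ℕ → ℕ

/-- The initial configuration: everything is zero. -/
def State.zero : State := ⟨fun _ => 0, fun _ => 0⟩

/-- The output: the content of register `0`, or `∞` if register `1` has been made nonzero. -/
def State.output (s : State) : ℕ∞ := if s.reg 1 = 0 then (s.reg 0 : ℕ∞) else ⊤

def State.setReg (s : State) (r a : ℕ) : State := { s with reg := Function.update s.reg r a }

def State.setMem (s : State) (i a : ℕ) : State := { s with mem := Function.update s.mem i a }

/-- The value of an operand for word size `w`. -/
def Operand.val (w : ℕ) (s : State) : Operand → ℕ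
  | .reg r => s.reg r
  | .lit a => a % 2 ^ w
  | .wordSize => w

/-- Word operations for word size `w`, modulo `2 ^ w` (with `a / 0 = 0` and `a mod 0 = a`). -/
def BinOp.eval (w : ℕ) (o : BinOp) (a b : ℕ) : ℕ :=
  match o with
  | .add => (a + b) % 2 ^ w
  | .sub => (a + (2 ^ w - b)) % 2 ^ w
  | .mul => (a * b) % 2 ^ w
  | .div => a / b
  | .mod => a % b
  | .and => a &&& b
  | .or => a ||| b
  | .xor => a ^^^ b
  | .shl => (a * 2 ^ b) % 2 ^ w
  | .shr => a / 2 ^ b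

def Cmp.holds (t : Cmp) (a b : ℕ) : Prop :=
  match t with
  | .eq => a = b
  | .ne => a ≠ b
  | .lt => a < b
  | .le => a ≤ b

/-- The number whose binary digits, least significant first, are the `len` consecutive bits of `x`
from position `pos` on; positions beyond the end of `x` read as `0`. -/
def readBits (x : List Bool) (pos len : ℕ) : ℕ :=
  ∑ i ∈ Finset.range len, if x.getD (pos + i) false then 2 ^ i else 0

/-- The effect of one instruction, for word size `w` and input strings `x` and `y`. -/
def Instr.step (w : ℕ) (x y : List Bool) (s : State) : Instr → State
  | .mov dst a => s.setReg dst (a.val w s)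
  | .op o dst a b => s.setReg dst (o.eval w (a.val w s) (b.val w s))
  | .load dst a => s.setReg dst (s.mem (a.val w s))
  | .store a b => s.setMem (a.val w s) (b.val w s)
  | .read dst which pos len =>
      s.setReg dst (readBits (if which then y else x) (pos.val w s) (min (len.val w s) w))

/-- `Exec w x y p s t s'`: started in `s`, with word size `w` and input strings `x` and `y`, the
program `p` terminates in `s'` after exactly `t` steps. Every executed instruction and every
evaluated test is one step. -/
inductive Exec (w : ℕ) (x y : List Bool) : Prog → State → ℕ → State → Prop where
  | skip (s : State) : Exec w x y .skip s 1 s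
  | instr (i : Instr) (s : State) : Exec w x y (.instr i) s 1 (i.step w x y s)
  | seq {p q : Prog} {s s' s'' : State} {t t' : ℕ} :
      Exec w x y p s t s' → Exec w x y q s' t' s'' → Exec w x y (.seq p q) s (t + t') s''
  | ite_true {c : Cmp} {a b : Operand} {p q : Prog} {s s' : State} {t : ℕ} :
      c.holds (a.val w s) (b.val w s) → Exec w x y p s t s' →
        Exec w x y (.ite c a b p q) s (t + 1) s'
  | ite_false {c : Cmp} {a b : Operand} {p q : Prog} {s s' : State} {t : ℕ} :
      ¬ c.holds (a.val w s) (b.val w s) → Exec w x y q s t s' →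
        Exec w x y (.ite c a b p q) s (t + 1) s'
  | while_false {c : Cmp} {a b : Operand} {p : Prog} {s : State} :
      ¬ c.holds (a.val w s) (b.val w s) → Exec w x y (.while c a b p) s 1 s
  | while_true {c : Cmp} {a b : Operand} {p : Prog} {s s' s'' : State} {t t' : ℕ} :
      c.holds (a.val w s) (b.val w s) → Exec w x y p s t s' →
        Exec w x y (.while c a b p) s' t' s'' →
        Exec w x y (.while c a b p) s (t + t' + 1) s''

/-- With word size `w`, the program `p` on the pair of input strings `x`, `y` terminates after
exactly `t` steps, with output `d`. -/
def Computes (w : ℕ) (p : Prog) (x y : List Bool) (t : ℕ) (d : ℕ∞) : Prop :=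
  ∃ s : State, Exec w x y p State.zero t s ∧ s.output = d

end WordRAM

/-! ### Cheapest walks -/

section Graph

variable {V : Type*} {G : SimpleGraph V} {c : Sym2 V → ℕ}

/-! Put d = ⌈Δ⌉ + 1 and give each node x the weight ⌊deg x / d⌋ + 1. The total weight is at most 2n
because the average degree is at most d. A node of large degree counts as a long piece of path, so
walks of weight below D from a fixed node reach at most (2d)^(D-1) nodes (`ncard_within_le`). No
bound on the maximum degree is needed.

Fix u. Along cheapest paths to u, each node x occupies an interval of depths of length equal to its
weight, and consecutive nodes occupy adjacent intervals (`exists_treeDepth`). Averaging over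
residues modulo D gives a residue met by at most 2n/D intervals (`exists_sparse_residue`). The nodes
owning these intervals, together with u, are the hubs of u. From any v in the component of u, a
cheapest path to u meets a hub before it has passed weight D (`exists_within_mem`). Hence δ(u,v) is
the minimum of δ(u,y) + δ(y,v) over hubs y of u in the small ball of v. The triangle inequality
gives one direction, the hub on the cheapest path the other.

It remains to store the O(n/D) hub distances with O(log D) bits each. Nodes are addressed by
positions on a tour of their component (`exists_tour`). Along it the distance to u changes by at
most 1 per step, so distance plus position is nondecreasing with increments at most 2. The tour is
cut into subblocks of D positions. A hub record is an offset and an increment within its subblock,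
and a subblock is summarized by its hub count and total increment. Full prefix sums are stored only
once per block of g subblocks. Within a block, a table indexed by the bits of the preceding
summaries gives the remaining sum in constant time (`subblock_lookup`).

The decoder runs through the ball of v and scans at most D records of u for each entry, taking O(D
(2d)^(D-1)) steps. With D of order R = log T / log Δ this is O(T), and the labels have O((n/D) log
D) bits (`exists_hopBound`, `length_hubLabel_mul_le`). -/

/-- The cost of a walk. -/
def walkCost (c : Sym2 V → ℕ) {u v : V} (p : G.Walk u v) : ℕ := (p.edges.map c).sum

lemma walkCost_cons {u v z : V} (h : G.Adj u v) (p : G.Walk v z) :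
    walkCost c (.cons h p) = c s(u, v) + walkCost c p := by
  simp [walkCost]

lemma walkCost_append {u v z : V} (p : G.Walk u v) (q : G.Walk v z) :
    walkCost c (p.append q) = walkCost c p + walkCost c q := by
  simp [walkCost]

lemma walkCost_reverse {u v : V} (p : G.Walk u v) : walkCost c p.reverse = walkCost c p := by
  simp [walkCost]

lemma walkCost_le_length (hc : ∀ e ∈ G.edgeSet, c e = 0 ∨ c e = 1) {u v : V} (p : G.Walk u v) :
    walkCost c p ≤ p.length := by
  induction p with
  | nil => simp [walkCost]
  | @cons a b _ h p ih =>
    rw [walkCost_cons, SimpleGraph.Walk.length_cons]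
    rcases hc s(a, b) h with h | h <;> omega

lemma costDist_eq_top {u v : V} (h : ¬ G.Reachable u v) : costDist G c u v = ⊤ := by
  have : IsEmpty (G.Walk u v) := ⟨fun p => h ⟨p⟩⟩
  simp [costDist]

/-- The distance as a natural number, `0` between different components. -/
noncomputable def natDist (G : SimpleGraph V) (c : Sym2 V → ℕ) (u v : V) : ℕ :=
  sInf (Set.range fun p : G.Walk u v => walkCost c p)

lemma natDist_le {u v : V} (p : G.Walk u v) : natDist G c u v ≤ walkCost c p :=
  Nat.sInf_le ⟨p, rfl⟩

lemma exists_walkCost_eq {u v : V} (h : G.Reachable u v) :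
    ∃ p : G.Walk u v, walkCost c p = natDist G c u v := by
  obtain ⟨p⟩ := h
  exact Nat.sInf_mem (s := Set.range fun p : G.Walk u v => walkCost c p) ⟨_, p, rfl⟩

lemma costDist_eq_natDist {u v : V} (h : G.Reachable u v) :
    costDist G c u v = (natDist G c u v : ℕ∞) := by
  apply le_antisymm
  · obtain ⟨p, hp⟩ := exists_walkCost_eq (c := c) h
    rw [← hp]
    exact iInf_le (fun p : G.Walk u v => (((p.edges.map c).sum : ℕ) : ℕ∞)) p
  · exact le_iInf fun p => by exact_mod_cast natDist_le (c := c) p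

lemma natDist_self (u : V) : natDist G c u u = 0 :=
  Nat.le_zero.1 (natDist_le (c := c) (.nil : G.Walk u u))

lemma natDist_triangle {u v z : V} (h₁ : G.Reachable u v) (h₂ : G.Reachable v z) :
    natDist G c u z ≤ natDist G c u v + natDist G c v z := by
  obtain ⟨p, hp⟩ := exists_walkCost_eq (c := c) h₁
  obtain ⟨q, hq⟩ := exists_walkCost_eq (c := c) h₂
  rw [← hp, ← hq, ← walkCost_append]
  exact natDist_le _

lemma natDist_comm {u v : V} (h : G.Reachable u v) : natDist G c u v = natDist G c v u := by
  obtain ⟨p, hp⟩ := exists_walkCost_eq (c := c) h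
  obtain ⟨q, hq⟩ := exists_walkCost_eq (c := c) h.symm
  have h₁ := natDist_le (c := c) p.reverse
  have h₂ := natDist_le (c := c) q.reverse
  rw [walkCost_reverse] at h₁ h₂
  omega

lemma natDist_adj_le (hc : ∀ e ∈ G.edgeSet, c e = 0 ∨ c e = 1) {u v : V} (h : G.Adj u v) :
    natDist G c u v ≤ 1 := by
  refine (natDist_le (.cons h .nil)).trans ((walkCost_le_length hc _).trans ?_)
  simp

lemma natDist_lt_card [Fintype V] (hc : ∀ e ∈ G.edgeSet, c e = 0 ∨ c e = 1) {u v : V}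
    (h : G.Reachable u v) : natDist G c u v < Fintype.card V := by
  classical
  obtain ⟨p⟩ := h
  exact ((natDist_le p.toPath.1).trans (walkCost_le_length hc _)).trans_lt p.toPath.2.length_lt

/-- A depth function for a tree of cheapest paths to `u`, in which passing the node `x` adds
`wt x`. -/
lemma exists_treeDepth (G : SimpleGraph V) (wt : V → ℕ) (c : Sym2 V → ℕ) (u : V) :
    ∃ W : V → ℕ, ∀ v, G.Reachable v u → v ≠ u → ∃ z, G.Adj v z ∧ W v = W z + wt z ∧
      natDist G c v u = c s(v, z) + natDist G c z u := by
  -- The start of the walk is not counted, and `u` is counted unless the walk is trivial.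
  let sw : ∀ {v : V}, G.Walk v u → ℕ := fun p => (p.darts.map fun d => wt d.snd).sum
  -- Edges of cost 0 leave the distance unchanged, so distance alone does not order a path.
  -- Minimizing weight among the cheapest walks breaks the ties consistently.
  let W : V → ℕ := fun v => sInf {k | ∃ p : G.Walk v u, walkCost c p = natDist G c v u ∧ sw p = k}
  have hW : ∀ v, G.Reachable v u → ∃ p : G.Walk v u, walkCost c p = natDist G c v u ∧ sw p = W v := by
    intro v hv
    obtain ⟨p, hp⟩ := exists_walkCost_eq (c := c) hv
    exact Nat.sInf_mem
      (s := {k | ∃ p : G.Walk v u, walkCost c p = natDist G c v u ∧ sw p = k}) ⟨_, p, hp, rfl⟩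
  have hle : ∀ {v} (p : G.Walk v u), walkCost c p = natDist G c v u → W v ≤ sw p :=
    fun p hp => Nat.sInf_le ⟨p, hp, rfl⟩
  refine ⟨W, fun v hv hvu => ?_⟩
  obtain ⟨p, hp, hs⟩ := hW v hv
  cases p with
  | nil => exact absurd rfl hvu
  | @cons _ z _ h q =>
    obtain ⟨r, hr, hrs⟩ := hW z ⟨q⟩
    have h₁ := natDist_le (c := c) q
    have h₂ := natDist_le (c := c) (.cons h r)
    rw [walkCost_cons] at hp h₂
    have hq : walkCost c q = natDist G c z u := by omega
    have h₃ := hle q hq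
    have h₄ := hle (.cons h r) (by rw [walkCost_cons]; omega)
    have h₅ : ∀ q : G.Walk z u, sw (.cons h q) = wt z + sw q := by intro q; simp [sw]
    rw [h₅] at h₄ hs
    exact ⟨z, h, by omega, by omega⟩

/-! ### Balls bounded by node weights -/

/-- `Within G wt k v y`: there is a walk from `v` to `y` whose nodes other than `y` have total
weight at most `k`. -/
inductive Within (G : SimpleGraph V) (wt : V → ℕ) : ℕ → V → V → Prop where
  | refl (k : ℕ) (v : V) : Within G wt k v v
  | step {k : ℕ} {v x y : V} : G.Adj v x → wt v ≤ k → Within G wt (k - wt v) x y → Within G wt k v y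

lemma Within.reachable {wt : V → ℕ} {k : ℕ} {v y : V} (h : Within G wt k v y) :
    G.Reachable v y := by
  induction h with
  | refl => exact .refl _
  | step h _ _ ih => exact h.reachable.trans ih

/-- Leaving a node of weight a multiplies the count by at most its degree plus one, hence by at most
d·a ≤ (2d)^a, and it uses up a of the budget. -/
lemma ncard_within_le [Fintype V] [DecidableRel G.Adj] {wt : V → ℕ} {d : ℕ} (hd : 1 ≤ d)
    (hw : ∀ v, 1 ≤ wt v) (hdeg : ∀ v, G.degree v < d * wt v) (k : ℕ) :
    ∀ v, {y | Within G wt k v y}.ncard ≤ (2 * d) ^ k := by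
  classical
  induction k using Nat.strong_induction_on with
  | _ k ih =>
    intro v
    by_cases hk : wt v ≤ k
    · have hsub : {y | Within G wt k v y} ⊆
          {v} ∪ ⋃ x ∈ G.neighborFinset v, {y | Within G wt (k - wt v) x y} := by
        rintro y hy
        cases hy with
        | refl => exact Or.inl rfl
        | @step _ _ x _ h _ h' =>
          refine Or.inr ?_
          simp only [Set.mem_iUnion]
          exact ⟨x, by simpa using h, h'⟩
      calc _ ≤ _ := Set.ncard_le_ncard hsub (Set.toFinite _)
        _ ≤ 1 + ∑ x ∈ G.neighborFinset v, {y | Within G wt (k - wt v) x y}.ncard := by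
          refine (Set.ncard_union_le _ _).trans ?_
          rw [Set.ncard_singleton]
          gcongr
          exact Finset.set_ncard_biUnion_le _ _
        _ ≤ 1 + ∑ x ∈ G.neighborFinset v, (2 * d) ^ (k - wt v) := by
          gcongr with x
          exact ih _ (by have := hw v; omega) x
        _ = 1 + G.degree v * (2 * d) ^ (k - wt v) := by simp
        _ ≤ (d * wt v) * (2 * d) ^ (k - wt v) := by
          have h1 : 1 ≤ (2 * d) ^ (k - wt v) := Nat.one_le_pow _ _ (by omega)
          have h2 := hdeg v
          nlinarith
        _ ≤ (2 * d) ^ wt v * (2 * d) ^ (k - wt v) := by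
          gcongr
          -- Uses a ≤ 2^a and d ≤ d^a for a = `wt v` ≥ 1.
          rw [mul_pow, mul_comm]
          exact Nat.mul_le_mul (Nat.lt_two_pow_self).le (Nat.le_self_pow (by have := hw v; omega) d)
        _ = (2 * d) ^ k := by rw [← pow_add]; congr 1; omega
    · have : {y | Within G wt k v y} = {v} := by
        ext y
        constructor
        · intro hy
          cases hy with
          | refl => rfl
          | step _ h => exact absurd h hk
        · rintro rfl
          exact .refl _ _
      rw [this, Set.ncard_singleton]
      exact Nat.one_le_pow _ _ (by omega)

/-- A cheapest path from `v` to `u` meets a node whose depth interval contains a number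
congruent to `i`, before the nodes passed have total weight `D`. -/
lemma exists_within_mem {wt W : V → ℕ} {u : V} {D i : ℕ} {S : Set V} (huS : u ∈ S)
    (hW : ∀ v, G.Reachable v u → v ≠ u → ∃ z, G.Adj v z ∧ W v = W z + wt z ∧
      natDist G c v u = c s(v, z) + natDist G c z u)
    (hS : ∀ x t, W x ≤ t → t < W x + wt x → t % D = i → x ∈ S) (hw : ∀ v, 1 ≤ wt v) (k : ℕ) :
    ∀ v, G.Reachable v u → k < D → (∃ t, t % D = i ∧ t < W v + wt v ∧ W v + wt v ≤ t + k + 1) →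
      ∃ y ∈ S, Within G wt k v y ∧ natDist G c v u = natDist G c v y + natDist G c y u := by
  induction k using Nat.strong_induction_on with
  | _ k ih =>
    rintro v hv hk ⟨t, hti, ht, htk⟩
    by_cases hvS : v ∈ S
    · exact ⟨v, hvS, .refl _ _, by rw [natDist_self, zero_add]⟩
    have hvu : v ≠ u := fun h => hvS (h ▸ huS)
    obtain ⟨z, hz, hWz, hdz⟩ := hW v hv hvu
    -- Otherwise `t` lies in the interval of `v`, making `v` a hub. So `t` lies below `W v`, the
    -- upper end of the interval of `z`, and the budget can drop by `wt v`.
    have htW : t < W v := by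
      by_contra h
      exact hvS (hS v t (by omega) ht hti)
    have hzu : G.Reachable z u := hz.symm.reachable.trans hv
    have hwv := hw v
    obtain ⟨y, hyS, hy, hd⟩ := ih (k - wt v) (by omega) z hzu (by omega) ⟨t, hti, by omega, by omega⟩
    refine ⟨y, hyS, .step hz (by omega) hy, ?_⟩
    have h₁ := natDist_triangle (c := c) hz.reachable hy.reachable
    have h₂ := natDist_triangle (c := c) (hz.reachable.trans hy.reachable)
      (hy.reachable.symm.trans hzu)
    have h₃ := natDist_le (c := c) (.cons hz .nil)
    rw [walkCost_cons] at h₃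
    simp only [walkCost, SimpleGraph.Walk.edges_nil, List.map_nil, List.sum_nil] at h₃
    omega

/-- One residue class of depths meets few depth intervals. -/
lemma exists_sparse_residue [Fintype V] (W wt : V → ℕ) {D : ℕ} (hD : 1 ≤ D) :
    ∃ i < D, {x | ∃ t, W x ≤ t ∧ t < W x + wt x ∧ t % D = i}.ncard * D ≤ ∑ x, wt x := by
  classical
  let S : ℕ → Finset V := fun i => {x | ∃ t, W x ≤ t ∧ t < W x + wt x ∧ t % D = i}
  -- Double counting: an interval of length `wt x` meets at most `wt x` residue classes.
  have hsum : ∑ i ∈ Finset.range D, (S i).card ≤ ∑ x, wt x := by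
    simp only [S, Finset.card_filter]
    rw [Finset.sum_comm]
    refine Finset.sum_le_sum fun x _ => ?_
    rw [← Finset.card_filter]
    calc _ ≤ ((Finset.Ico (W x) (W x + wt x)).image (· % D)).card := by
          apply Finset.card_le_card
          intro i hi
          obtain ⟨t, h₁, h₂, h₃⟩ := (Finset.mem_filter.1 hi).2
          exact Finset.mem_image.2 ⟨t, Finset.mem_Ico.2 ⟨h₁, h₂⟩, h₃⟩
      _ ≤ _ := Finset.card_image_le
      _ = wt x := by simp
  obtain ⟨i, hi, hmin⟩ := Finset.exists_min_image (Finset.range D) (fun i => (S i).card)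
    ⟨0, Finset.mem_range.2 (by omega)⟩
  refine ⟨i, Finset.mem_range.1 hi, ?_⟩
  have h := Finset.card_nsmul_le_sum _ _ _ hmin
  rw [Finset.card_range, smul_eq_mul] at h
  have : {x | ∃ t, W x ≤ t ∧ t < W x + wt x ∧ t % D = i} = (S i : Set V) := by ext; simp [S]
  rw [this, Set.ncard_coe_finset, mul_comm]
  exact h.trans hsum

/-! ### Tours of components -/

/-- A connected component can be toured by a walk of linear length. -/
lemma exists_tour [Fintype V] (C : G.ConnectedComponent) :
    ∃ p : ℕ → V, (∀ j, p (j + 1) = p j ∨ G.Adj (p j) (p (j + 1))) ∧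
      (∀ j, G.connectedComponentMk (p j) = C) ∧
      ∀ x, G.connectedComponentMk x = C → ∃ j ≤ 2 * Fintype.card V, p j = x := by
  classical
  obtain ⟨r, rfl⟩ := C.exists_rep
  -- While the list misses a reachable node, some edge `a b` leaves it. Replacing one occurrence of
  -- `a` by `a, b, a` gains a new node for two more entries.
  have key : ∀ k : ℕ, ∃ l : List V, l ≠ [] ∧ l.IsChain G.Adj ∧ (∀ x ∈ l, G.Reachable x r) ∧
      l.length ≤ 2 * k + 1 ∧ ((∀ x, G.Reachable x r → x ∈ l) ∨ k + 1 ≤ l.toFinset.card) := by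
    intro k
    induction k with
    | zero => exact ⟨[r], by simp, by simp, by simp, by simp, Or.inr (by simp)⟩
    | succ k ih =>
      obtain ⟨l, hne, hch, hr, hlen, h⟩ := ih
      by_cases hall : ∀ x, G.Reachable x r → x ∈ l
      · exact ⟨l, hne, hch, hr, by omega, Or.inl hall⟩
      have hcard := h.resolve_left hall
      push Not at hall
      obtain ⟨x, hx, hxl⟩ := hall
      obtain ⟨y, hy⟩ := List.exists_mem_of_ne_nil l hne
      obtain ⟨q⟩ := (hr y hy).trans hx.symm
      obtain ⟨⟨⟨a, b⟩, hab⟩, -, ha, hb⟩ := q.exists_boundary_dart {z | z ∈ l} hy hxl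
      simp only [Set.mem_ofPred_eq] at ha hb hab
      obtain ⟨l₁, l₂, rfl⟩ := List.append_of_mem ha
      have hbr : G.Reachable b r := hab.symm.reachable.trans (hr a ha)
      refine ⟨l₁ ++ a :: b :: a :: l₂, by simp, ?_, ?_, ?_, Or.inr ?_⟩
      · rw [List.isChain_split] at hch ⊢
        exact ⟨hch.1, by simpa [hab, hab.symm] using hch.2⟩
      · intro z hz
        simp only [List.mem_append, List.mem_cons] at hz
        rcases hz with hz | rfl | rfl | rfl | hz
        · exact hr z (by simp [hz])
        · exact hr z ha
        · exact hbr
        · exact hr z ha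
        · exact hr z (by simp [hz])
      · simp only [List.length_append, List.length_cons] at hlen ⊢
        omega
      · have : (l₁ ++ a :: b :: a :: l₂).toFinset = insert b (l₁ ++ a :: l₂).toFinset := by
          ext z; simp only [List.mem_toFinset, List.mem_append, List.mem_cons, Finset.mem_insert]; tauto
        rw [this, Finset.card_insert_of_notMem (by rwa [List.mem_toFinset])]
        omega
  obtain ⟨l, hne, hch, hr, hlen, h⟩ := key (Fintype.card V)
  have hall : ∀ x, G.Reachable x r → x ∈ l := by
    refine h.resolve_right fun h => ?_
    have := Finset.card_le_univ l.toFinset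
    omega
  have hpos : 0 < l.length := List.length_pos_iff.2 hne
  -- The tour stays at its last node forever, which is why a stationary step is allowed.
  refine ⟨fun j => l[min j (l.length - 1)]'(by omega), fun j => ?_, fun j => ?_, fun x hx => ?_⟩
  · by_cases hj : j + 1 < l.length
    · right
      have := (List.isChain_iff_getElem.1 hch) j hj
      simpa only [min_eq_left (show j ≤ l.length - 1 by omega),
        min_eq_left (show j + 1 ≤ l.length - 1 by omega)] using this
    · left
      simp only [min_eq_right (show l.length - 1 ≤ j + 1 by omega),
        min_eq_right (show l.length - 1 ≤ j by omega)]
  · exact SimpleGraph.ConnectedComponent.sound (hr _ (List.getElem_mem _))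
  · obtain ⟨j, hj, hjx⟩ := List.getElem_of_mem (hall x (SimpleGraph.ConnectedComponent.exact hx))
    refine ⟨j, by omega, ?_⟩
    simpa only [min_eq_left (show j ≤ l.length - 1 by omega)] using hjx

/-! ### The hub structure -/

/-- Each node `u` of a graph with costs `0` and `1` has a sparse set `A u` of hubs, given by
positions on a tour of its component, and a small ball around itself, such that all distances are
decoded from the hubs of `u` in the ball of `v`. The number `h u j - j` is the distance from `u` to
the node at position `j`, and the ball consists of pairs of a position and a distance. -/
theorem exists_hub_structure [Fintype V] (hc : ∀ e ∈ G.edgeSet, c e = 0 ∨ c e = 1)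
    {D d : ℕ} (hD : 1 ≤ D) (hd : 1 ≤ d)
    (hm : 2 * G.edgeSet.ncard ≤ d * Fintype.card V) :
    ∃ (comp : V → ℕ) (h : V → ℕ → ℕ) (A : V → Finset ℕ) (ball : V → List (ℕ × ℕ)),
      (∀ u, comp u ≤ Fintype.card V) ∧
      (∀ u j, h u j ≤ h u (j + 1) ∧ h u (j + 1) ≤ h u j + 2) ∧
      (∀ u, h u 0 ≤ Fintype.card V) ∧
      (∀ u, (A u).card * D ≤ 2 * Fintype.card V + D) ∧
      (∀ v, (ball v).length ≤ (2 * d) ^ (D - 1)) ∧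
      (∀ v, ∀ a ∈ ball v, a.1 ≤ 2 * Fintype.card V ∧ a.2 ≤ Fintype.card V) ∧
      (∀ u v, comp u ≠ comp v → costDist G c u v = ⊤) ∧
      ∀ u v, comp u = comp v → ∃ δ : ℕ, δ ≤ Fintype.card V ∧ costDist G c u v = δ ∧
        (∀ a ∈ ball v, a.1 ∈ A u → δ + a.1 ≤ h u a.1 + a.2) ∧
        ∃ a ∈ ball v, a.1 ∈ A u ∧ h u a.1 + a.2 = δ + a.1 := by
  classical
  set n := Fintype.card V with hn
  choose p hp hpC hpos using fun C : G.ConnectedComponent => exists_tour C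
  have : Fintype G.ConnectedComponent := Fintype.ofFinite _
  have hcardC : Fintype.card G.ConnectedComponent ≤ n :=
    Fintype.card_le_of_surjective G.connectedComponentMk Quot.mk_surjective
  let comp : V → ℕ := fun u => Fintype.equivFin _ (G.connectedComponentMk u)
  have hcomp : ∀ u v, comp u = comp v ↔ G.Reachable u v := fun u v => by
    simp only [comp, Fin.val_inj, EmbeddingLike.apply_eq_iff_eq, SimpleGraph.ConnectedComponent.eq]
  have hpos' : ∀ x, ∃ j ≤ 2 * n, p (G.connectedComponentMk x) j = x := fun x => hpos _ x rfl
  choose pos hposle hpospos using hpos'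
  let wt : V → ℕ := fun v => G.degree v / d + 1
  have hwt : ∀ v, 1 ≤ wt v := fun v => by simp [wt]
  have hdeg : ∀ v, G.degree v < d * wt v := fun v => Nat.lt_mul_div_succ _ (by omega)
  -- The quotients sum to at most n by the degree sum, and the added ones contribute another n.
  have hsum : ∑ v, wt v ≤ 2 * n := by
    have h₁ : ∑ v, G.degree v ≤ d * n := by
      rw [SimpleGraph.sum_degrees_eq_twice_card_edges]
      rwa [← Set.ncard_coe_finset, SimpleGraph.coe_edgeFinset]
    have h₂ : (∑ v, G.degree v / d) * d ≤ n * d := by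
      rw [Finset.sum_mul, mul_comm n]
      exact (Finset.sum_le_sum fun v _ => Nat.div_mul_le_self _ _).trans h₁
    have h₃ := Nat.le_of_mul_le_mul_right h₂ (by omega)
    simp only [wt, Finset.sum_add_distrib, Finset.sum_const, Finset.card_univ, smul_eq_mul]
    omega
  choose W₀ hW₀ using fun u => exists_treeDepth G wt c u
  -- Depths are shifted by `D` so that at least one number of the chosen residue lies below every
  -- interval top. If that number lies below the interval of `u`, the path reaches `u` first, which
  -- is itself a hub.
  let W : V → V → ℕ := fun u x => W₀ u x + D
  choose i hiD hi using fun u => exists_sparse_residue (W u) wt hD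
  let S : V → Set V := fun u => insert u {x | ∃ t, W u x ≤ t ∧ t < W u x + wt x ∧ t % D = i u}
  have hScard : ∀ u, (S u).ncard * D ≤ 2 * n + D := by
    intro u
    calc _ ≤ ({x | ∃ t, W u x ≤ t ∧ t < W u x + wt x ∧ t % D = i u}.ncard + 1) * D := by
          gcongr; exact Set.ncard_insert_le _ _
      _ ≤ _ := by rw [add_mul, one_mul]; exact Nat.add_le_add_right ((hi u).trans hsum) _
  -- Positions on tours of different components coincide, so the hubs must be restricted to the
  -- component of `u` for a position to identify a node.
  let A : V → Finset ℕ := fun u =>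
    ((S u).toFinset.filter fun x => G.connectedComponentMk x = G.connectedComponentMk u).image pos
  have hA : ∀ u x, G.Reachable x u → (pos x ∈ A u ↔ x ∈ S u) := by
    intro u x hx
    have hx' := SimpleGraph.ConnectedComponent.sound hx
    simp only [A, Finset.mem_image, Finset.mem_filter, Set.mem_toFinset]
    constructor
    · rintro ⟨y, ⟨hy, hyu⟩, hxy⟩
      have h₁ := hpospos x
      have h₂ := hpospos y
      rw [hx', ← hxy, ← hyu, h₂] at h₁
      exact h₁ ▸ hy
    · exact fun h => ⟨x, ⟨h, hx'⟩, rfl⟩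
  have hfin : ∀ v, {y | Within G wt (D - 1) v y}.Finite := fun v => Set.toFinite _
  let ball : V → List (ℕ × ℕ) := fun v =>
    (hfin v).toFinset.toList.map fun y => (pos y, natDist G c v y)
  have hball : ∀ v a, a ∈ ball v ↔ ∃ y, Within G wt (D - 1) v y ∧ (pos y, natDist G c v y) = a := by
    intro v a
    simp [ball]
  have hval : ∀ u y, G.Reachable y u → p (G.connectedComponentMk u) (pos y) = y := by
    intro u y h
    rw [← SimpleGraph.ConnectedComponent.sound h]
    exact hpospos y
  refine ⟨comp, fun u j => natDist G c u (p (G.connectedComponentMk u) j) + j, A, ball,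
    fun u => (Fin.is_lt _).le.trans hcardC, fun u j => ?_, fun u => ?_, fun u => ?_,
    fun v => ?_, fun v a ha => ?_, fun u v huv => ?_, fun u v huv => ?_⟩
  · have hr : ∀ j, G.Reachable u (p (G.connectedComponentMk u) j) := fun j =>
      (SimpleGraph.ConnectedComponent.exact (hpC _ j)).symm
    rcases hp (G.connectedComponentMk u) j with h | h
    · simp only [h]; omega
    · have h₁ := natDist_triangle (c := c) (hr j) h.reachable
      have h₂ := natDist_triangle (c := c) (hr (j + 1)) h.symm.reachable
      have h₃ := natDist_adj_le hc h
      have h₄ := natDist_adj_le hc h.symm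
      simp only
      omega
  · exact (natDist_lt_card hc (SimpleGraph.ConnectedComponent.exact (hpC _ 0)).symm).le
  · refine le_trans (Nat.mul_le_mul_right _ ?_) (hScard u)
    refine Finset.card_image_le.trans ((Finset.card_filter_le _ _).trans ?_)
    rw [Set.ncard_eq_toFinset_card']
  · simp only [ball, List.length_map, Finset.length_toList]
    rw [← Set.ncard_eq_toFinset_card _ (hfin v)]
    exact ncard_within_le hd hwt hdeg _ v
  · obtain ⟨y, hy, rfl⟩ := (hball v a).1 ha
    exact ⟨hposle y, (natDist_lt_card hc hy.reachable).le⟩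
  · exact costDist_eq_top fun h => huv ((hcomp u v).2 h)
  · have hr := (hcomp u v).1 huv
    refine ⟨natDist G c u v, (natDist_lt_card hc hr).le, costDist_eq_natDist hr, ?_, ?_⟩
    · intro a ha _
      obtain ⟨y, hy, rfl⟩ := (hball v a).1 ha
      have hyr := hy.reachable
      simp only [hval u y (hyr.symm.trans hr.symm)]
      have h₁ := natDist_triangle (c := c) (hr.trans hyr) hyr.symm
      have h₂ := natDist_comm (c := c) hyr
      omega
    · have hex : ∃ t, t % D = i u ∧ t < W u v + wt v ∧ W u v + wt v ≤ t + (D - 1) + 1 := by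
        have hX : D ≤ W u v + wt v - 1 := by have := hwt v; simp only [W]; omega
        have hw := hwt v
        generalize hXe : W u v + wt v - 1 = X at hX
        have hiu := hiD u
        have hmod := Nat.div_add_mod X D
        have hlt := Nat.mod_lt X (show D > 0 by omega)
        have hdiv : 1 ≤ X / D := (Nat.one_le_div_iff (by omega)).2 hX
        by_cases hle : i u ≤ X % D
        · refine ⟨D * (X / D) + i u, ?_, by omega, by omega⟩
          rw [Nat.mul_add_mod, Nat.mod_eq_of_lt hiu]
        · have : D * (X / D - 1) + D = D * (X / D) := by
            rw [← Nat.mul_succ]; congr 1; omega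
          refine ⟨D * (X / D - 1) + i u, ?_, by omega, by omega⟩
          rw [Nat.mul_add_mod, Nat.mod_eq_of_lt hiu]
      obtain ⟨y, hyS, hy, hdy⟩ := exists_within_mem (c := c) (S := S u) (W := W u) (D := D) (i := i u)
        (Set.mem_insert _ _)
        (fun x hx hxu => by
          obtain ⟨z, h₁, h₂, h₃⟩ := hW₀ u x hx hxu
          exact ⟨z, h₁, by simp only [W]; omega, h₃⟩)
        (fun x t h₁ h₂ h₃ => Or.inr ⟨t, h₁, h₂, h₃⟩) hwt (D - 1) v hr.symm (by omega) hex
      have hyr := hy.reachable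
      have hyu := hyr.symm.trans hr.symm
      refine ⟨_, (hball v _).2 ⟨y, hy, rfl⟩, (hA u y hyu).2 hyS, ?_⟩
      simp only [hval u y hyu]
      have h₁ := natDist_comm (c := c) hr
      have h₂ := natDist_comm (c := c) hyu
      omega

end Graph

/-! ### Reading bit strings -/

open WordRAM

lemma readBits_add (x : List Bool) (p a b : ℕ) :
    readBits x p (a + b) = readBits x p a + 2 ^ a * readBits x (p + a) b := by
  simp only [readBits, Finset.sum_range_add, Finset.mul_sum]
  congr 1
  refine Finset.sum_congr rfl fun i _ => ?_
  rw [add_assoc]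
  split <;> simp [pow_add]

lemma readBits_lt (x : List Bool) (p l : ℕ) : readBits x p l < 2 ^ l := by
  induction l with
  | zero => simp [readBits]
  | succ l ih =>
    rw [readBits_add, pow_succ]
    have : readBits x (p + l) 1 ≤ 1 := by simp [readBits]; split <;> simp
    nlinarith [Nat.zero_le (2 ^ l)]

lemma readBits_append_right (x y : List Bool) (p l : ℕ) :
    readBits (x ++ y) (x.length + p) l = readBits y p l := by
  refine Finset.sum_congr rfl fun i _ => ?_
  rw [List.getD_append_right _ _ _ _ (by omega)]
  congr 3
  omega

lemma readBits_append_left {x : List Bool} (y : List Bool) {p l : ℕ} (h : p + l ≤ x.length) :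
    readBits (x ++ y) p l = readBits x p l := by
  refine Finset.sum_congr rfl fun i hi => ?_
  rw [List.getD_append _ _ _ _ (by have := Finset.mem_range.1 hi; omega)]

/-- The lowest `l` binary digits of `v`, least significant first. -/
def encodeNat (l v : ℕ) : List Bool := (List.range l).map v.testBit

@[simp] lemma length_encodeNat (l v : ℕ) : (encodeNat l v).length = l := by simp [encodeNat]

lemma readBits_encodeNat {l v : ℕ} (h : v < 2 ^ l) : readBits (encodeNat l v) 0 l = v := by
  have key : ∀ k ≤ l, readBits (encodeNat l v) 0 k = v % 2 ^ k := by
    intro k hk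
    induction k with
    | zero => simp [readBits, Nat.mod_one]
    | succ k ih =>
      rw [readBits_add, ih (by omega), pow_succ, Nat.mod_mul, zero_add]
      congr 2
      simp only [readBits, encodeNat, Finset.range_one, Finset.sum_singleton, add_zero, pow_zero]
      rw [List.getD_eq_getElem _ _ (by simpa using hk)]
      simp only [List.getElem_map, List.getElem_range]
      rw [Nat.testBit_eq_decide_div_mod_eq]
      rcases Nat.mod_two_eq_zero_or_one (v / 2 ^ k) with h | h <;> simp [h]
  rw [key l le_rfl, Nat.mod_eq_of_lt h]

lemma length_flatMap_uniform {ι : Type*} {F : ι → List Bool} {m : ℕ} :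
    ∀ {l : List ι}, (∀ a ∈ l, (F a).length = m) → (l.flatMap F).length = l.length * m
  | [], _ => by simp
  | a :: l, h => by
    rw [List.flatMap_cons, List.length_append, h a (by simp),
      length_flatMap_uniform fun b hb => h b (by simp [hb]), List.length_cons, add_mul, one_mul,
      add_comm]

lemma readBits_flatMap_uniform {ι : Type*} {F : ι → List Bool} {m : ℕ} {l : List ι}
    (h : ∀ a ∈ l, (F a).length = m) {i p k : ℕ} (hi : i < l.length) (hk : p + k ≤ m) :
    readBits (l.flatMap F) (i * m + p) k = readBits (F l[i]) p k := by
  induction l generalizing i with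
  | nil => simp at hi
  | cons a l ih =>
    rw [List.flatMap_cons]
    have ha := h a (by simp)
    cases i with
    | zero => simpa using readBits_append_left (l.flatMap F) (by omega : p + k ≤ (F a).length)
    | succ i =>
      rw [show (i + 1) * m + p = (F a).length + (i * m + p) by rw [ha]; ring,
        readBits_append_right, ih (fun b hb => h b (by simp [hb])) (by simpa using hi)]
      simp

/-- An array of `l`-bit words. -/
def encodeList (l : ℕ) (vs : List ℕ) : List Bool := vs.flatMap (encodeNat l)

lemma length_encodeList (l : ℕ) (vs : List ℕ) : (encodeList l vs).length = vs.length * l :=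
  length_flatMap_uniform fun _ _ => by simp

lemma encodeList_append (l : ℕ) (vs ws : List ℕ) :
    encodeList l (vs ++ ws) = encodeList l vs ++ encodeList l ws := by simp [encodeList]

lemma readBits_encodeList {l : ℕ} {vs : List ℕ} {i : ℕ} (hi : i < vs.length)
    (h : vs[i] < 2 ^ l) : readBits (encodeList l vs) (i * l) l = vs[i] := by
  have := readBits_flatMap_uniform (F := encodeNat l) (m := l) (l := vs) (p := 0) (k := l)
    (fun _ _ => by simp) hi (by omega)
  rw [add_zero, readBits_encodeNat h] at this
  exact this

/-- The sum of `φ` over the `g` lowest digits of `z` in base `b`. -/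
def digitSum (φ : ℕ → ℕ) (b : ℕ) : ℕ → ℕ → ℕ
  | 0, _ => 0
  | g + 1, z => φ (z % b) + digitSum φ b g (z / b)

lemma digitSum_zero_right {φ : ℕ → ℕ} (h : φ 0 = 0) (b g : ℕ) : digitSum φ b g 0 = 0 := by
  induction g with
  | zero => rfl
  | succ g ih => simp [digitSum, h, ih]

lemma digitSum_le {φ : ℕ → ℕ} {b B : ℕ} (hb : 0 < b) (h : ∀ v < b, φ v ≤ B) (g z : ℕ) :
    digitSum φ b g z ≤ g * B := by
  induction g generalizing z with
  | zero => simp [digitSum]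
  | succ g ih =>
    rw [digitSum, add_mul, one_mul, add_comm]
    exact Nat.add_le_add (ih _) (h _ (Nat.mod_lt _ hb))

/-- The bits beyond the `r` words read are zero and `φ 0 = 0`. One table for exactly `g` digits
therefore serves every shorter prefix. -/
lemma digitSum_readBits {φ : ℕ → ℕ} (h : φ 0 = 0) {l g r : ℕ} {vs : List ℕ}
    (hv : ∀ v ∈ vs, v < 2 ^ l) (hr : r ≤ vs.length) (hg : r ≤ g) :
    digitSum φ (2 ^ l) g (readBits (encodeList l vs) 0 (r * l)) = ((vs.take r).map φ).sum := by
  induction r generalizing vs g with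
  | zero => simp [readBits, digitSum_zero_right h]
  | succ r ih =>
    cases vs with
    | nil => simp at hr
    | cons v vs =>
      cases g with
      | zero => simp at hg
      | succ g =>
        have hv0 : v < 2 ^ l := hv v (by simp)
        have e : encodeList l (v :: vs) = encodeNat l v ++ encodeList l vs := by simp [encodeList]
        have e2 := readBits_append_right (encodeNat l v) (encodeList l vs) 0 (r * l)
        rw [length_encodeNat, add_zero] at e2
        rw [show (r + 1) * l = l + r * l by ring, readBits_add, e, zero_add, e2,
          readBits_append_left _ (by simp), readBits_encodeNat hv0, digitSum,
          Nat.add_mul_mod_self_left, Nat.mod_eq_of_lt hv0, Nat.add_mul_div_left _ _ (by positivity),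
          Nat.div_eq_of_lt hv0, zero_add, ih (fun v hv' => hv v (by simp [hv'])) (by simpa using hr)
          (by omega)]
        simp

/-! ### Labels -/

/-- Half the width of the entries of a subblock of `D` tour positions. -/
def halfWidth (D : ℕ) : ℕ := Nat.log 2 D + 2

lemma two_mul_lt_two_pow_halfWidth (D : ℕ) : 2 * D < 2 ^ halfWidth D := by
  have := Nat.lt_pow_succ_log_self (b := 2) (by norm_num) D
  rw [halfWidth, show Nat.log 2 D + 2 = (Nat.log 2 D).succ + 1 by omega, pow_succ]
  omega

/-- The hubs in the `q`-th subblock: offset, and increment of `h` since the start of the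
subblock. -/
def subRecords (D : ℕ) (h : ℕ → ℕ) (A : Finset ℕ) (q : ℕ) : List ℕ :=
  ((List.range D).filter fun o => q * D + o ∈ A).map
    fun o => o + 2 ^ halfWidth D * (h (q * D + o) - h (q * D))

/-- The number of hubs before the `q`-th subblock. -/
def hubRank (D : ℕ) (h : ℕ → ℕ) (A : Finset ℕ) (q : ℕ) : ℕ :=
  ∑ i ∈ Finset.range q, (subRecords D h A i).length

/-- The summary of the `q`-th subblock: number of hubs and increment of `h`. -/
def summary (D : ℕ) (h : ℕ → ℕ) (A : Finset ℕ) (q : ℕ) : ℕ :=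
  (subRecords D h A q).length + 2 ^ halfWidth D * (h ((q + 1) * D) - h (q * D))

/-- The two entries of a summary, repacked into the two halves of a word of `2 * H` bits. -/
def unpackSummary (D H v : ℕ) : ℕ := v % 2 ^ halfWidth D + 2 ^ H * (v / 2 ^ halfWidth D)

/-- The accumulated summaries of all subblocks before the `q`-th. -/
def packedPrefix (D H : ℕ) (h : ℕ → ℕ) (A : Finset ℕ) (q : ℕ) : ℕ :=
  hubRank D h A q + 2 ^ H * h (q * D)

/-! ### Summaries of subblocks and their prefix sums. -/

section Increments

variable {D H : ℕ} {h : ℕ → ℕ} {A : Finset ℕ}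

lemma monotone_and_le_of_increments (hh : ∀ j, h j ≤ h (j + 1) ∧ h (j + 1) ≤ h j + 2) (j i : ℕ) :
    h j ≤ h (j + i) ∧ h (j + i) ≤ h j + 2 * i := by
  induction i with
  | zero => simp
  | succ i ih => have := hh (j + i); rw [← add_assoc]; omega

lemma length_subRecords_le (q : ℕ) : (subRecords D h A q).length ≤ D := by
  rw [subRecords, List.length_map]
  exact (List.length_filter_le _ _).trans (by simp)

lemma subRecords_lt (hh : ∀ j, h j ≤ h (j + 1) ∧ h (j + 1) ≤ h j + 2) (q : ℕ) :
    ∀ v ∈ subRecords D h A q, v < 2 ^ (2 * halfWidth D) := by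
  intro v hv
  simp only [subRecords, List.mem_map, List.mem_filter, List.mem_range] at hv
  obtain ⟨o, ⟨ho, -⟩, rfl⟩ := hv
  have h₁ := monotone_and_le_of_increments hh (q * D) o
  have h₂ := two_mul_lt_two_pow_halfWidth D
  rw [two_mul, pow_add]
  have h₃ : h (q * D + o) - h (q * D) + 1 ≤ 2 ^ halfWidth D := by omega
  have h₄ := Nat.mul_le_mul_left (2 ^ halfWidth D) h₃
  rw [mul_add] at h₄
  omega

/-- The count is at most D and the increment at most 2D, so each fits into `halfWidth D` bits. -/
lemma summary_parts (hh : ∀ j, h j ≤ h (j + 1) ∧ h (j + 1) ≤ h j + 2) (q : ℕ) :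
    summary D h A q < 2 ^ (2 * halfWidth D) ∧
      summary D h A q % 2 ^ halfWidth D = (subRecords D h A q).length ∧
      summary D h A q / 2 ^ halfWidth D = h ((q + 1) * D) - h (q * D) := by
  have h₀ := length_subRecords_le (D := D) (h := h) (A := A) q
  have h₁ := monotone_and_le_of_increments hh (q * D) D
  rw [← Nat.succ_mul, Nat.succ_eq_add_one] at h₁
  have h₂ := two_mul_lt_two_pow_halfWidth D
  have hlt : (subRecords D h A q).length < 2 ^ halfWidth D := by omega
  refine ⟨?_, ?_, ?_⟩
  · rw [two_mul, pow_add, summary]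
    have h₃ : h ((q + 1) * D) - h (q * D) + 1 ≤ 2 ^ halfWidth D := by omega
    have h₄ := Nat.mul_le_mul_left (2 ^ halfWidth D) h₃
    rw [mul_add] at h₄
    omega
  · rw [summary, Nat.add_mul_mod_self_left, Nat.mod_eq_of_lt hlt]
  · rw [summary, Nat.add_mul_div_left _ _ (by positivity), Nat.div_eq_of_lt hlt, zero_add]

/-- A repacked summary is exactly the change of the packed prefix across one subblock. Monotonicity
of `h` makes the truncated subtraction exact, so the sums telescope. -/
lemma packedPrefix_add (hh : ∀ j, h j ≤ h (j + 1) ∧ h (j + 1) ≤ h j + 2) (q r : ℕ) :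
    packedPrefix D H h A (q + r) = packedPrefix D H h A q +
      ∑ i ∈ Finset.range r, unpackSummary D H (summary D h A (q + i)) := by
  induction r with
  | zero => simp
  | succ r ih =>
    rw [← add_assoc, Finset.sum_range_succ, ← add_assoc (packedPrefix D H h A q), ← ih, unpackSummary,
      (summary_parts hh _).2.1, (summary_parts hh _).2.2, packedPrefix, packedPrefix, hubRank,
      Finset.sum_range_succ, ← hubRank]
    have h₁ := (monotone_and_le_of_increments hh ((q + r) * D) D).1
    rw [← Nat.succ_mul, Nat.succ_eq_add_one] at h₁
    have h₂ : 2 ^ H * h ((q + r + 1) * D) =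
        2 ^ H * h ((q + r) * D) + 2 ^ H * (h ((q + r + 1) * D) - h ((q + r) * D)) := by
      rw [← mul_add]; congr 1; omega
    omega

/-- Subblocks are disjoint ranges of positions, so each record counted is a different hub below `q *
D`. -/
lemma hubRank_le_card (q : ℕ) : hubRank D h A q ≤ A.card := by
  have key : hubRank D h A q ≤ (A.filter (· < q * D)).card := by
    induction q with
    | zero => simp [hubRank]
    | succ q ih =>
      rw [hubRank, Finset.sum_range_succ, ← hubRank]
      have hsub : (subRecords D h A q).length ≤
          (A.filter fun j => q * D ≤ j ∧ j < (q + 1) * D).card := by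
        rw [subRecords, List.length_map,
          ← List.toFinset_card_of_nodup (List.nodup_range.filter _),
          ← Finset.card_image_of_injective _ (add_right_injective (q * D))]
        apply Finset.card_le_card
        intro j hj
        simp only [Finset.mem_image, List.mem_toFinset, List.mem_filter, List.mem_range,
          decide_eq_true_eq] at hj
        obtain ⟨o, ⟨ho, hoA⟩, rfl⟩ := hj
        rw [Finset.mem_filter, Nat.succ_mul]
        exact ⟨hoA, by omega, by omega⟩
      calc _ ≤ _ := Nat.add_le_add ih hsub
        _ = _ := by
          rw [← Finset.card_union_of_disjoint]
          · congr 1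
            ext j
            simp only [Finset.mem_union, Finset.mem_filter, Nat.succ_mul]
            constructor
            · rintro (⟨h, h'⟩ | ⟨h, h'⟩) <;> exact ⟨h, by omega⟩
            · rintro ⟨h, h'⟩
              by_cases hj : j < q * D
              · exact Or.inl ⟨h, hj⟩
              · exact Or.inr ⟨h, by omega, by omega⟩
          · rw [Finset.disjoint_left]
            intro j h₁ h₂
            rw [Finset.mem_filter] at h₁ h₂
            omega
  exact key.trans (Finset.card_filter_le _ _)

lemma length_flatMap_subRecords (q : ℕ) :
    ((List.range q).flatMap (subRecords D h A)).length = hubRank D h A q := by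
  induction q with
  | zero => simp [hubRank]
  | succ q ih =>
    rw [List.range_succ, List.flatMap_append, List.length_append, ih, hubRank, hubRank,
      Finset.sum_range_succ]
    simp

end Increments

/-! ### Bit layout of a label and random access to its fields. -/

section Label

variable (w D g M nb : ℕ)

/-- Start of the blocks in a label. -/
def blockBase : ℕ := 7 * w + 2 ^ (g * (2 * halfWidth D)) * w

/-- Length of a block. -/
def blockLength : ℕ := w + g * (2 * halfWidth D)

/-- Start of the ball in a label. -/
def ballBase : ℕ := blockBase w D g + nb * blockLength w D g

/-- The table of sums of summaries. -/
def summaryTable : List ℕ := (List.range (2 ^ (g * (2 * halfWidth D)))).map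
  (digitSum (unpackSummary D (w / 2)) (2 ^ (2 * halfWidth D)) g)

/-- A block: the accumulated summaries, followed by `g` summaries. -/
def block (h : ℕ → ℕ) (A : Finset ℕ) (b : ℕ) : List Bool :=
  encodeNat w (packedPrefix D (w / 2) h A (b * g)) ++
    encodeList (2 * halfWidth D) ((List.range g).map fun i => summary D h A (b * g + i))

/-- A ball entry: where to find the summaries, offset in the subblock, distance, position. -/
def ballEntry (a : ℕ × ℕ) : List ℕ :=
  [blockBase w D g + a.1 / D / g * blockLength w D g, a.1 / D % g * (2 * halfWidth D),
    a.1 % D, a.2, a.1]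

/-- The header of a label. -/
def labelHeader (comp : ℕ) (ball : List (ℕ × ℕ)) : List ℕ :=
  [comp, ball.length, ballBase w D g nb, 2 * halfWidth D, 2 ^ halfWidth D, 7 * w,
    ballBase w D g nb + ball.length * (5 * w)]

/-- The label of a node with component `comp`, tour function `h`, hubs `A` and ball `ball`. -/
def hubLabel (comp : ℕ) (h : ℕ → ℕ) (A : Finset ℕ) (ball : List (ℕ × ℕ)) : List Bool :=
  encodeList w (labelHeader w D g nb comp ball) ++ (encodeList w (summaryTable w D g) ++
    ((List.range nb).flatMap (block w D g h A) ++
      (ball.flatMap (fun a => encodeList w (ballEntry w D g a)) ++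
        encodeList (2 * halfWidth D) ((List.range M).flatMap (subRecords D h A)))))

variable {w D g M nb} {comp : ℕ} {h : ℕ → ℕ} {A : Finset ℕ} {ball : List (ℕ × ℕ)}

lemma length_block (b : ℕ) : (block w D g h A b).length = blockLength w D g := by
  simp [block, length_encodeList, blockLength]

lemma length_blocks :
    ((List.range nb).flatMap (block w D g h A)).length = nb * blockLength w D g := by
  rw [length_flatMap_uniform fun b _ => length_block b, List.length_range]

lemma length_ball : (ball.flatMap fun a => encodeList w (ballEntry w D g a)).length =
    ball.length * (5 * w) :=
  length_flatMap_uniform fun a _ => by rw [length_encodeList]; rfl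

lemma length_table : (encodeList w (summaryTable w D g)).length =
    2 ^ (g * (2 * halfWidth D)) * w := by simp [length_encodeList, summaryTable]

lemma length_header : (encodeList w (labelHeader w D g nb comp ball)).length = 7 * w := by
  rw [length_encodeList]; rfl

lemma length_hubLabel : (hubLabel w D g M nb comp h A ball).length =
    ballBase w D g nb + ball.length * (5 * w) + hubRank D h A M * (2 * halfWidth D) := by
  simp only [hubLabel, List.length_append, length_header, length_table, length_blocks, length_ball,
    length_encodeList (2 * halfWidth D), length_flatMap_subRecords, ballBase, blockBase]
  ring

lemma readBits_append_of_eq {x : List Bool} (y : List Bool) {q p l : ℕ} (hq : q = x.length + p) :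
    readBits (x ++ y) q l = readBits y p l := by rw [hq, readBits_append_right]

lemma readBits_header {i : ℕ} (hi : i < 7)
    (hlt : (labelHeader w D g nb comp ball)[i]'(by exact hi) < 2 ^ w) :
    readBits (hubLabel w D g M nb comp h A ball) (i * w) w =
      (labelHeader w D g nb comp ball)[i]'(by exact hi) := by
  rw [hubLabel, readBits_append_left, readBits_encodeList _ hlt]
  rw [length_header]
  nlinarith

lemma readBits_table {z : ℕ} (hz : z < 2 ^ (g * (2 * halfWidth D)))
    (hlt : digitSum (unpackSummary D (w / 2)) (2 ^ (2 * halfWidth D)) g z < 2 ^ w) :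
    readBits (hubLabel w D g M nb comp h A ball) (7 * w + z * w) w =
      digitSum (unpackSummary D (w / 2)) (2 ^ (2 * halfWidth D)) g z := by
  have hl : z < (summaryTable w D g).length := by simpa [summaryTable] using hz
  have hget : (summaryTable w D g)[z] =
    digitSum (unpackSummary D (w / 2)) (2 ^ (2 * halfWidth D)) g z := by simp [summaryTable]
  rw [hubLabel, readBits_append_of_eq (p := z * w) _ (by rw [length_header]), readBits_append_left,
    readBits_encodeList hl (by rw [hget]; exact hlt), hget]
  rw [length_table]
  nlinarith

lemma readBits_block {b p k : ℕ} (hb : b < nb) (hp : p + k ≤ blockLength w D g) :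
    readBits (hubLabel w D g M nb comp h A ball)
      (blockBase w D g + b * blockLength w D g + p) k = readBits (block w D g h A b) p k := by
  rw [hubLabel, readBits_append_of_eq
      (p := 2 ^ (g * (2 * halfWidth D)) * w + (b * blockLength w D g + p)) _
      (by rw [length_header, blockBase]; ring),
    readBits_append_of_eq (p := b * blockLength w D g + p) _ (by rw [length_table]),
    readBits_append_left,
    readBits_flatMap_uniform (fun b _ => length_block b) (by simpa using hb) hp, List.getElem_range]
  rw [length_blocks]
  have := Nat.mul_le_mul_right (blockLength w D g) hb
  rw [Nat.succ_mul] at this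
  omega

lemma readBits_ball {i t : ℕ} (hi : i < ball.length) (ht : t < 5)
    (hlt : (ballEntry w D g ball[i])[t]'(by exact ht) < 2 ^ w) :
    readBits (hubLabel w D g M nb comp h A ball) (ballBase w D g nb + i * (5 * w) + t * w) w =
      (ballEntry w D g ball[i])[t]'(by exact ht) := by
  have ht' : t * w + w ≤ 5 * w := by nlinarith
  rw [hubLabel, readBits_append_of_eq (p := 2 ^ (g * (2 * halfWidth D)) * w +
      (nb * blockLength w D g + (i * (5 * w) + t * w))) _
      (by rw [length_header, ballBase, blockBase]; ring),
    readBits_append_of_eq (p := nb * blockLength w D g + (i * (5 * w) + t * w)) _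
      (by rw [length_table]),
    readBits_append_of_eq (p := i * (5 * w) + t * w) _ (by rw [length_blocks]),
    readBits_append_left,
    readBits_flatMap_uniform (fun a _ => by rw [length_encodeList]; rfl) hi ht',
    readBits_encodeList _ hlt]
  rw [length_ball]
  have := Nat.mul_le_mul_right (5 * w) hi
  rw [Nat.succ_mul] at this
  omega

/-- Records of all subblocks are stored consecutively without padding, so the rank of a subblock is
the index of its first record. -/
lemma readBits_record (hh : ∀ j, h j ≤ h (j + 1) ∧ h (j + 1) ≤ h j + 2) {q i : ℕ} (hq : q < M)
    (hi : i < (subRecords D h A q).length) :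
    readBits (hubLabel w D g M nb comp h A ball)
      (ballBase w D g nb + ball.length * (5 * w) + (hubRank D h A q + i) * (2 * halfWidth D))
      (2 * halfWidth D) = (subRecords D h A q)[i] := by
  rw [hubLabel, readBits_append_of_eq (p := 2 ^ (g * (2 * halfWidth D)) * w +
      (nb * blockLength w D g + (ball.length * (5 * w) +
        (hubRank D h A q + i) * (2 * halfWidth D)))) _
      (by rw [length_header, ballBase, blockBase]; ring),
    readBits_append_of_eq (p := nb * blockLength w D g + (ball.length * (5 * w) +
        (hubRank D h A q + i) * (2 * halfWidth D))) _ (by rw [length_table]),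
    readBits_append_of_eq (p := ball.length * (5 * w) +
        (hubRank D h A q + i) * (2 * halfWidth D)) _ (by rw [length_blocks]),
    readBits_append_of_eq (p := (hubRank D h A q + i) * (2 * halfWidth D)) _ (by rw [length_ball])]
  -- The record array splits into the records before subblock `q`, those of `q`, and the rest.
  obtain ⟨m, rfl⟩ : ∃ m, M = q + 1 + m := ⟨M - (q + 1), by omega⟩
  rw [List.range_add, List.flatMap_append, List.range_succ, List.flatMap_append, List.append_assoc,
    List.flatMap_singleton, encodeList_append, encodeList_append,
    readBits_append_of_eq (p := i * (2 * halfWidth D)) _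
      (by rw [length_encodeList, length_flatMap_subRecords]; ring),
    readBits_append_left _ (by
      rw [length_encodeList]
      have := Nat.mul_le_mul_right (2 * halfWidth D) hi
      rw [Nat.succ_mul] at this
      omega),
    readBits_encodeList hi (subRecords_lt hh q _ (List.getElem_mem _))]

/-- All reads needed to look up the subblock `q` in a label. -/
lemma subblock_lookup (hh : ∀ j, h j ≤ h (j + 1) ∧ h (j + 1) ≤ h j + 2) {q : ℕ} (hg : 0 < g)
    (hqb : q / g < nb) (hP : ∀ q < M, packedPrefix D (w / 2) h A q < 2 ^ w) (hq : q < M)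
    (hT : ∀ z, digitSum (unpackSummary D (w / 2)) (2 ^ (2 * halfWidth D)) g z < 2 ^ w) :
    ∃ P z t, readBits (hubLabel w D g M nb comp h A ball)
        (blockBase w D g + q / g * blockLength w D g) w = P ∧
      readBits (hubLabel w D g M nb comp h A ball)
        (blockBase w D g + q / g * blockLength w D g + w) (q % g * (2 * halfWidth D)) = z ∧
      readBits (hubLabel w D g M nb comp h A ball) (7 * w + z * w) w = t ∧
      readBits (hubLabel w D g M nb comp h A ball)
        (blockBase w D g + q / g * blockLength w D g + w + q % g * (2 * halfWidth D))
        (2 * halfWidth D) = summary D h A q ∧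
      z < 2 ^ (g * (2 * halfWidth D)) ∧ P + t = packedPrefix D (w / 2) h A q := by
  have hr := Nat.mod_lt q hg
  have hdm : q / g * g + q % g = q := by rw [mul_comm]; exact Nat.div_add_mod q g
  have hrl : q % g * (2 * halfWidth D) + 2 * halfWidth D ≤ g * (2 * halfWidth D) := by
    rw [← Nat.succ_mul]; exact Nat.mul_le_mul_right _ hr
  have hlt : ∀ v ∈ (List.range g).map (fun i => summary D h A (q / g * g + i)),
      v < 2 ^ (2 * halfWidth D) := by
    intro v hv
    obtain ⟨i, -, rfl⟩ := List.mem_map.1 hv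
    exact (summary_parts hh _).1
  have e₁ := readBits_block (w := w) (D := D) (g := g) (M := M) (comp := comp) (h := h) (A := A)
    (ball := ball) (p := 0) (k := w) hqb (by rw [blockLength]; omega)
  have e₂ := readBits_block (w := w) (D := D) (g := g) (M := M) (comp := comp) (h := h) (A := A)
    (ball := ball) (p := w) (k := q % g * (2 * halfWidth D)) hqb (by rw [blockLength]; omega)
  have e₃ := readBits_block (w := w) (D := D) (g := g) (M := M) (comp := comp) (h := h) (A := A)
    (ball := ball) (p := w + q % g * (2 * halfWidth D)) (k := 2 * halfWidth D) hqb
    (by rw [blockLength]; omega)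
  have hz : readBits (block w D g h A (q / g)) w (q % g * (2 * halfWidth D)) <
      2 ^ (g * (2 * halfWidth D)) :=
    (readBits_lt _ _ _).trans_le (Nat.pow_le_pow_right (by norm_num) (by omega))
  rw [add_zero] at e₁
  refine ⟨_, _, _, e₁, e₂, readBits_table hz (hT _), ?_, hz, ?_⟩
  · rw [add_assoc, e₃, block, readBits_append_of_eq (p := q % g * (2 * halfWidth D)) _ (by simp),
      readBits_encodeList (by simpa using hr) (hlt _ (List.getElem_mem _))]
    simp [hdm]
  · rw [block, readBits_append_left _ (by simp),
      readBits_encodeNat (hP _ ((Nat.div_mul_le_self _ _).trans_lt hq)),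
      readBits_append_of_eq (x := encodeNat w _) (p := 0) _ (by simp),
      digitSum_readBits (by simp [unpackSummary]) hlt (by simpa using hr.le) hr.le, ← List.map_take,
      List.take_range, min_eq_left hr.le, List.map_map]
    conv_rhs => rw [← hdm, packedPrefix_add hh]
    rfl

end Label

/-! ### Running programs -/

namespace WordRAM

/-- Started in `s`, the program `p` terminates after at most `t` steps in a state satisfying `Q`. -/
def Runs (w : ℕ) (x y : List Bool) (p : Prog) (s : State) (t : ℕ) (Q : State → Prop) : Prop :=
  ∃ s' t', t' ≤ t ∧ Exec w x y p s t' s' ∧ Q s'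

lemma reg_setReg (s : State) (r a i : ℕ) :
    (s.setReg r a).reg i = if i = r then a else s.reg i := by
  simp [State.setReg, Function.update_apply]

section

variable {w : ℕ} {x y : List Bool} {s : State} {t t' : ℕ} {p q : Prog} {Q Q' : State → Prop}

lemma Runs.mono (h : Runs w x y p s t Q) (ht : t ≤ t') (hQ : ∀ s, Q s → Q' s) :
    Runs w x y p s t' Q' := by
  obtain ⟨s', t₁, h₁, h₂, h₃⟩ := h
  exact ⟨s', t₁, h₁.trans ht, h₂, hQ _ h₃⟩

lemma Runs.skip (h : Q s) : Runs w x y .skip s 1 Q := ⟨s, 1, le_rfl, .skip s, h⟩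

lemma Runs.instr {i : Instr} (r v : ℕ) (hi : i.step w x y s = s.setReg r v)
    (h : Q (s.setReg r v)) : Runs w x y (.instr i) s 1 Q :=
  ⟨_, 1, le_rfl, .instr i s, by rwa [hi]⟩

lemma Runs.seq (h : Runs w x y p s t fun s' => Runs w x y q s' t' Q) :
    Runs w x y (.seq p q) s (t + t') Q := by
  obtain ⟨s₁, t₁, h₁, h₂, s₂, t₂, h₃, h₄, h₅⟩ := h
  exact ⟨s₂, _, Nat.add_le_add h₁ h₃, .seq h₂ h₄, h₅⟩

lemma Runs.step {i : Instr} (r v : ℕ) (hi : i.step w x y s = s.setReg r v)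
    (h : Runs w x y q (s.setReg r v) t Q) : Runs w x y (.seq (.instr i) q) s (t + 1) Q :=
  (Runs.seq (Runs.instr r v hi h)).mono (by omega) fun _ h => h

lemma Runs.ite_true {c : Cmp} {a b : Operand} (hc : c.holds (a.val w s) (b.val w s))
    (h : Runs w x y p s t Q) : Runs w x y (.ite c a b p q) s (t + 1) Q := by
  obtain ⟨s', t₁, h₁, h₂, h₃⟩ := h
  exact ⟨s', _, Nat.add_le_add_right h₁ 1, .ite_true hc h₂, h₃⟩

lemma Runs.ite_false {c : Cmp} {a b : Operand} (hc : ¬ c.holds (a.val w s) (b.val w s))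
    (h : Runs w x y q s t Q) : Runs w x y (.ite c a b p q) s (t + 1) Q := by
  obtain ⟨s', t₁, h₁, h₂, h₃⟩ := h
  exact ⟨s', _, Nat.add_le_add_right h₁ 1, .ite_false hc h₂, h₃⟩

lemma Runs.while_false {c : Cmp} {a b : Operand} (hc : ¬ c.holds (a.val w s) (b.val w s))
    (h : Q s) : Runs w x y (.while c a b p) s 1 Q := ⟨s, 1, le_rfl, .while_false hc, h⟩

lemma Runs.while_true {c : Cmp} {a b : Operand} (hc : c.holds (a.val w s) (b.val w s))
    (h : Runs w x y p s t fun s' => Runs w x y (.while c a b p) s' t' Q) :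
    Runs w x y (.while c a b p) s (t + t' + 1) Q := by
  obtain ⟨s₁, t₁, h₁, h₂, s₂, t₂, h₃, h₄, h₅⟩ := h
  exact ⟨s₂, _, Nat.add_le_add_right (Nat.add_le_add h₁ h₃) 1, .while_true hc h₂ h₄, h₅⟩

end

lemma sub_mod_two_pow {w a b : ℕ} (hb : b ≤ a) (ha : a < 2 ^ w) :
    (a + (2 ^ w - b)) % 2 ^ w = a - b := by
  rw [show a + (2 ^ w - b) = (a - b) + 2 ^ w by omega, Nat.add_mod_right,
    Nat.mod_eq_of_lt (by omega)]

/-! ### The decoder -/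

open Operand in
/-- Compares one hub record with the current ball entry and updates the best distance. -/
def scanBody : Prog :=
  .seq (.instr (.read 21 false (reg 20) (reg 4))) <|
  .seq (.instr (.op .add 20 (reg 20) (reg 4))) <|
  .seq (.instr (.op .mod 22 (reg 21) (reg 5))) <|
  .seq (.instr (.op .sub 18 (reg 18) (lit 1))) <|
  .ite .eq (reg 22) (reg 12)
    (.seq (.instr (.op .div 23 (reg 21) (reg 5))) <|
    .seq (.instr (.op .add 23 (reg 23) (reg 15))) <|
    .seq (.instr (.op .add 23 (reg 23) (reg 13))) <|
    .seq (.instr (.op .sub 23 (reg 23) (reg 14))) <|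
    .ite .lt (reg 23) (reg 0) (.instr (.mov 0 (reg 23))) .skip)
    .skip

/-- Scans the hub records of a subblock. -/
def scanLoop : Prog := .while .ne (.reg 18) (.lit 0) scanBody

/-- Register 0 holds the running minimum. Matching candidates are never below `δ`, so a lower bound
`δ` on register 0 is preserved, and at the end register 0 is at most every matching candidate. -/
lemma scanLoop_runs {w f S o e j h δ : ℕ} {x y : List Bool} (hf : f ≤ w) (k : ℕ) :
    ∀ (pos : ℕ) (rec : ℕ → ℕ) (s : State),
      (∀ i < k, readBits x (pos + i * f) f = rec i) → k < 2 ^ w → pos + k * f < 2 ^ w →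
      (∀ i < k, rec i % S = o → δ + j ≤ rec i / S + h + e ∧ rec i / S + h + e < 2 ^ w) →
      s.reg 18 = k → s.reg 20 = pos → s.reg 4 = f → s.reg 5 = S → s.reg 12 = o → s.reg 13 = e →
      s.reg 14 = j → s.reg 15 = h →
      Runs w x y scanLoop s (12 * k + 1) fun s' =>
        (∀ r, 0 < r → r < 18 → s'.reg r = s.reg r) ∧ s'.reg 0 ≤ s.reg 0 ∧
        (δ ≤ s.reg 0 → δ ≤ s'.reg 0) ∧ ∀ i < k, rec i % S = o → s'.reg 0 + j ≤ rec i / S + h + e := by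
  induction k with
  | zero =>
    intro pos rec s _ _ _ _ h18 _ _ _ _ _ _ _
    refine Runs.while_false ?_ ⟨fun _ _ _ => rfl, le_rfl, id, fun i hi => absurd hi (by omega)⟩
    simp [Cmp.holds, Operand.val, h18]
  | succ k ih =>
    intro pos rec s hrec hk hpos hcand h18 h20 h4 h5 h12 h13 h14 h15
    have h1w : 1 % 2 ^ w = 1 := Nat.mod_eq_of_lt (by omega)
    have hpos' : pos + f + k * f = pos + (k + 1) * f := by ring
    have hkf := Nat.zero_le (k * f)
    have hr0 : readBits x pos f = rec 0 := by simpa using hrec 0 (by omega)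
    have hadd : (pos + f) % 2 ^ w = pos + f := Nat.mod_eq_of_lt (by omega)
    have hsub : (k + 1 + (2 ^ w - 1)) % 2 ^ w = k := sub_mod_two_pow (by omega) hk
    have hrec' : ∀ i < k, readBits x (pos + f + i * f) f = rec (i + 1) := by
      intro i hi
      rw [← hrec (i + 1) (by omega)]
      congr 1
      ring
    have hcand' : ∀ i < k, rec (i + 1) % S = o →
        δ + j ≤ rec (i + 1) / S + h + e ∧ rec (i + 1) / S + h + e < 2 ^ w :=
      fun i hi => hcand (i + 1) (by omega)
    refine (Runs.while_true (t := 11) (t' := 12 * k + 1) ?_ ?_).mono (by omega) fun _ h => h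
    · simp [Cmp.holds, Operand.val, h18]
    refine Runs.step 21 (rec 0) (by simp [Instr.step, Operand.val, h20, h4, hf, hr0]) ?_
    refine Runs.step 20 (pos + f)
      (by simp [Instr.step, Operand.val, BinOp.eval, reg_setReg, h20, h4, hadd]) ?_
    refine Runs.step 22 (rec 0 % S)
      (by simp [Instr.step, Operand.val, BinOp.eval, reg_setReg, h5]) ?_
    refine Runs.step 18 k
      (by simp [Instr.step, Operand.val, BinOp.eval, reg_setReg, h18, h1w, hsub]) ?_
    -- The common continuation of the three branches: improvement, match without improvement, no
    -- match.
    have finish : ∀ s' : State, (∀ r, 0 < r → r < 18 → s'.reg r = s.reg r) → s'.reg 18 = k →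
        s'.reg 20 = pos + f → s'.reg 0 ≤ s.reg 0 → (δ ≤ s.reg 0 → δ ≤ s'.reg 0) →
        (rec 0 % S = o → s'.reg 0 + j ≤ rec 0 / S + h + e) →
        Runs w x y scanLoop s' (12 * k + 1) fun s' =>
          (∀ r, 0 < r → r < 18 → s'.reg r = s.reg r) ∧ s'.reg 0 ≤ s.reg 0 ∧
          (δ ≤ s.reg 0 → δ ≤ s'.reg 0) ∧
          ∀ i < k + 1, rec i % S = o → s'.reg 0 + j ≤ rec i / S + h + e := by
      intro s' hfr h18' h20' hle hδ hgood
      refine (ih (pos + f) (fun i => rec (i + 1)) s' hrec' (by omega) (by omega) hcand' h18' h20'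
        (by rw [hfr] <;> omega) (by rw [hfr] <;> omega) (by rw [hfr] <;> omega)
        (by rw [hfr] <;> omega) (by rw [hfr] <;> omega) (by rw [hfr] <;> omega)).mono le_rfl ?_
      rintro s₂ ⟨h₁, h₂, h₃, h₄⟩
      refine ⟨fun r hr hr' => (h₁ r hr hr').trans (hfr r hr hr'), h₂.trans hle, h₃ ∘ hδ, ?_⟩
      intro i hi hio
      cases i with
      | zero => have := hgood hio; omega
      | succ i => exact h₄ i (by omega) hio
    have hframe : ∀ r, 0 < r → r < 18 → r ≠ 0 ∧ r ≠ 18 ∧ r ≠ 20 ∧ r ≠ 21 ∧ r ≠ 22 ∧ r ≠ 23 := by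
      intro r _ _; omega
    by_cases ho : rec 0 % S = o
    · obtain ⟨hc₁, hc₂⟩ := hcand 0 (by omega) ho
      have e₁ : (rec 0 / S + h) % 2 ^ w = rec 0 / S + h := Nat.mod_eq_of_lt (by omega)
      have e₂ : (rec 0 / S + h + e) % 2 ^ w = rec 0 / S + h + e := Nat.mod_eq_of_lt hc₂
      have e₃ : (rec 0 / S + h + e + (2 ^ w - j)) % 2 ^ w = rec 0 / S + h + e - j :=
        sub_mod_two_pow (by omega) hc₂
      refine Runs.ite_true (t := 6) (by simp [Cmp.holds, Operand.val, reg_setReg, ho, h12]) ?_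
      refine Runs.step 23 (rec 0 / S)
        (by simp [Instr.step, Operand.val, BinOp.eval, reg_setReg, h5]) ?_
      refine Runs.step 23 (rec 0 / S + h)
        (by simp [Instr.step, Operand.val, BinOp.eval, reg_setReg, h15, e₁]) ?_
      refine Runs.step 23 (rec 0 / S + h + e)
        (by simp [Instr.step, Operand.val, BinOp.eval, reg_setReg, h13, e₂]) ?_
      refine Runs.step 23 (rec 0 / S + h + e - j)
        (by simp [Instr.step, Operand.val, BinOp.eval, reg_setReg, h14, e₃]) ?_
      by_cases hlt : rec 0 / S + h + e - j < s.reg 0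
      · refine Runs.ite_true (by simpa [Cmp.holds, Operand.val, reg_setReg] using hlt) ?_
        refine Runs.instr 0 (rec 0 / S + h + e - j) (by simp [Instr.step, Operand.val, reg_setReg]) ?_
        refine finish _ (fun r hr hr' => ?_) ?_ ?_ ?_ ?_ ?_
        · simp [reg_setReg, hframe r hr hr']
        all_goals simp [reg_setReg]
        all_goals omega
      · refine Runs.ite_false (by simpa [Cmp.holds, Operand.val, reg_setReg] using hlt) ?_
        refine Runs.skip (finish _ (fun r hr hr' => ?_) ?_ ?_ ?_ ?_ ?_)
        · simp [reg_setReg, hframe r hr hr']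
        all_goals simp [reg_setReg]
        all_goals omega
    · refine (Runs.ite_false (t := 1)
        (by simpa [Cmp.holds, Operand.val, reg_setReg, h12] using ho) ?_).mono
        (by omega) fun _ h => h
      refine Runs.skip (finish _ (fun r hr hr' => ?_) ?_ ?_ ?_ ?_ (fun h => absurd h ho))
      · simp [reg_setReg, hframe r hr hr']
      all_goals simp [reg_setReg]

open Operand in
/-- Reads one ball entry, looks up its subblock, and scans the hub records there. -/
def entryBody : Prog :=
  .seq (.instr (.read 10 true (reg 3) wordSize)) <|
  .seq (.instr (.op .add 3 (reg 3) wordSize)) <|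
  .seq (.instr (.read 11 true (reg 3) wordSize)) <|
  .seq (.instr (.op .add 3 (reg 3) wordSize)) <|
  .seq (.instr (.read 12 true (reg 3) wordSize)) <|
  .seq (.instr (.op .add 3 (reg 3) wordSize)) <|
  .seq (.instr (.read 13 true (reg 3) wordSize)) <|
  .seq (.instr (.op .add 3 (reg 3) wordSize)) <|
  .seq (.instr (.read 14 true (reg 3) wordSize)) <|
  .seq (.instr (.op .add 3 (reg 3) wordSize)) <|
  .seq (.instr (.op .sub 2 (reg 2) (lit 1))) <|
  .seq (.instr (.read 15 false (reg 10) wordSize)) <|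
  .seq (.instr (.op .add 10 (reg 10) wordSize)) <|
  .seq (.instr (.read 16 false (reg 10) (reg 11))) <|
  .seq (.instr (.op .add 10 (reg 10) (reg 11))) <|
  .seq (.instr (.read 17 false (reg 10) (reg 4))) <|
  .seq (.instr (.op .mul 16 (reg 16) wordSize)) <|
  .seq (.instr (.op .add 16 (reg 6) (reg 16))) <|
  .seq (.instr (.read 16 false (reg 16) wordSize)) <|
  .seq (.instr (.op .add 15 (reg 15) (reg 16))) <|
  .seq (.instr (.op .mod 20 (reg 15) (reg 9))) <|
  .seq (.instr (.op .mul 20 (reg 20) (reg 4))) <|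
  .seq (.instr (.op .add 20 (reg 7) (reg 20))) <|
  .seq (.instr (.op .mod 18 (reg 17) (reg 5))) <|
  .seq (.instr (.op .shr 15 (reg 15) (reg 8)))
  scanLoop

/-- Processes all ball entries. -/
def entryLoop : Prog := .while .ne (.reg 2) (.lit 0) entryBody

/-- The registers holding the parameters of the labels. -/
def Params (w f S TB RB : ℕ) (s : State) : Prop :=
  s.reg 1 = 0 ∧ s.reg 4 = f ∧ s.reg 5 = S ∧ s.reg 6 = TB ∧ s.reg 7 = RB ∧ s.reg 8 = w / 2 ∧
    s.reg 9 = 2 ^ (w / 2)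

/-- Separates execution from the label format: every word read is a hypothesis. Here `P` is the
prefix at the block, `z` the bits of the preceding summaries in the block, and `t` the table value.
The two halves of `P + t` are the hub rank `K` and the value `h` at the start of the subblock,
recovered by a remainder and a shift. -/
lemma entryBody_runs {w f S TB RB N p A l o e j P z t F K k h δ : ℕ} {x y : List Bool} {rec : ℕ → ℕ}
    {s : State} (hs : Params w f S TB RB s) (h2 : s.reg 2 = N + 1) (h3 : s.reg 3 = p)
    (hw : 1 ≤ w) (hf : f ≤ w) (hl : l ≤ w) (hN : N + 1 < 2 ^ w) (hp : p + 5 * w < 2 ^ w)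
    (r₀ : readBits y p w = A) (r₁ : readBits y (p + w) w = l)
    (r₂ : readBits y (p + w + w) w = o) (r₃ : readBits y (p + w + w + w) w = e)
    (r₄ : readBits y (p + w + w + w + w) w = j)
    (r₅ : readBits x A w = P) (r₆ : readBits x (A + w) l = z)
    (r₇ : readBits x (A + w + l) f = F) (r₈ : readBits x (TB + z * w) w = t)
    (hA : A + w + l < 2 ^ w) (hz : TB + z * w < 2 ^ w) (hPt : P + t = K + 2 ^ (w / 2) * h)
    (hPt' : P + t < 2 ^ w) (hK : K < 2 ^ (w / 2)) (hF : F % S = k) (hk : k < 2 ^ w)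
    (hpos : RB + (K + k) * f < 2 ^ w)
    (hrec : ∀ i < k, readBits x (RB + (K + i) * f) f = rec i)
    (hcand : ∀ i < k, rec i % S = o → δ + j ≤ rec i / S + h + e ∧ rec i / S + h + e < 2 ^ w) :
    Runs w x y entryBody s (12 * k + 26) fun s' =>
      Params w f S TB RB s' ∧ s'.reg 2 = N ∧ s'.reg 3 = p + 5 * w ∧ s'.reg 0 ≤ s.reg 0 ∧
        (δ ≤ s.reg 0 → δ ≤ s'.reg 0) ∧
        ∀ i < k, rec i % S = o → s'.reg 0 + j ≤ rec i / S + h + e := by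
  obtain ⟨g1, g4, g5, g6, g7, g8, g9⟩ := hs
  have h1w : 1 % 2 ^ w = 1 := Nat.mod_eq_of_lt (by omega)
  have m₁ : (p + w) % 2 ^ w = p + w := Nat.mod_eq_of_lt (by omega)
  have m₂ : (p + w + w) % 2 ^ w = p + w + w := Nat.mod_eq_of_lt (by omega)
  have m₃ : (p + w + w + w) % 2 ^ w = p + w + w + w := Nat.mod_eq_of_lt (by omega)
  have m₄ : (p + w + w + w + w) % 2 ^ w = p + w + w + w + w := Nat.mod_eq_of_lt (by omega)
  have m₅ : (p + w + w + w + w + w) % 2 ^ w = p + w + w + w + w + w := Nat.mod_eq_of_lt (by omega)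
  have m₆ : (N + 1 + (2 ^ w - 1)) % 2 ^ w = N := sub_mod_two_pow (by omega) hN
  have m₇ : (A + w) % 2 ^ w = A + w := Nat.mod_eq_of_lt (by omega)
  have m₈ : (A + w + l) % 2 ^ w = A + w + l := Nat.mod_eq_of_lt hA
  have m₉ : (z * w) % 2 ^ w = z * w := Nat.mod_eq_of_lt (by omega)
  have m₁₀ : (TB + z * w) % 2 ^ w = TB + z * w := Nat.mod_eq_of_lt hz
  have m₁₁ : (P + t) % 2 ^ w = P + t := Nat.mod_eq_of_lt hPt'
  have m₁₂ : (P + t) % 2 ^ (w / 2) = K := by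
    rw [hPt, Nat.add_mul_mod_self_left, Nat.mod_eq_of_lt hK]
  have m₁₃ : (P + t) / 2 ^ (w / 2) = h := by
    rw [hPt, Nat.add_mul_div_left _ _ (by positivity), Nat.div_eq_of_lt hK, zero_add]
  have hKf : K * f + k * f = (K + k) * f := by ring
  have m₁₄ : (K * f) % 2 ^ w = K * f := Nat.mod_eq_of_lt (by omega)
  have m₁₅ : (RB + K * f) % 2 ^ w = RB + K * f := Nat.mod_eq_of_lt (by omega)
  refine Runs.step 10 A (by simp [Instr.step, Operand.val, h3, r₀]) ?_
  refine Runs.step 3 (p + w)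
    (by simp [Instr.step, Operand.val, BinOp.eval, reg_setReg, h3, m₁]) ?_
  refine Runs.step 11 l (by simp [Instr.step, Operand.val, reg_setReg, r₁]) ?_
  refine Runs.step 3 (p + w + w)
    (by simp [Instr.step, Operand.val, BinOp.eval, reg_setReg, m₂]) ?_
  refine Runs.step 12 o (by simp [Instr.step, Operand.val, reg_setReg, r₂]) ?_
  refine Runs.step 3 (p + w + w + w)
    (by simp [Instr.step, Operand.val, BinOp.eval, reg_setReg, m₃]) ?_
  refine Runs.step 13 e (by simp [Instr.step, Operand.val, reg_setReg, r₃]) ?_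
  refine Runs.step 3 (p + w + w + w + w)
    (by simp [Instr.step, Operand.val, BinOp.eval, reg_setReg, m₄]) ?_
  refine Runs.step 14 j (by simp [Instr.step, Operand.val, reg_setReg, r₄]) ?_
  refine Runs.step 3 (p + w + w + w + w + w)
    (by simp [Instr.step, Operand.val, BinOp.eval, reg_setReg, m₅]) ?_
  refine Runs.step 2 N
    (by simp [Instr.step, Operand.val, BinOp.eval, reg_setReg, h2, h1w, m₆]) ?_
  refine Runs.step 15 P (by simp [Instr.step, Operand.val, reg_setReg, r₅]) ?_
  refine Runs.step 10 (A + w) (by simp [Instr.step, Operand.val, BinOp.eval, reg_setReg, m₇]) ?_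
  refine Runs.step 16 z (by simp [Instr.step, Operand.val, reg_setReg, hl, r₆]) ?_
  refine Runs.step 10 (A + w + l)
    (by simp [Instr.step, Operand.val, BinOp.eval, reg_setReg, m₈]) ?_
  refine Runs.step 17 F (by simp [Instr.step, Operand.val, reg_setReg, g4, hf, r₇]) ?_
  refine Runs.step 16 (z * w) (by simp [Instr.step, Operand.val, BinOp.eval, reg_setReg, m₉]) ?_
  refine Runs.step 16 (TB + z * w)
    (by simp [Instr.step, Operand.val, BinOp.eval, reg_setReg, g6, m₁₀]) ?_
  refine Runs.step 16 t (by simp [Instr.step, Operand.val, reg_setReg, r₈]) ?_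
  refine Runs.step 15 (P + t)
    (by simp [Instr.step, Operand.val, BinOp.eval, reg_setReg, m₁₁]) ?_
  refine Runs.step 20 K (by simp [Instr.step, Operand.val, BinOp.eval, reg_setReg, g9, m₁₂]) ?_
  refine Runs.step 20 (K * f)
    (by simp [Instr.step, Operand.val, BinOp.eval, reg_setReg, g4, m₁₄]) ?_
  refine Runs.step 20 (RB + K * f)
    (by simp [Instr.step, Operand.val, BinOp.eval, reg_setReg, g7, m₁₅]) ?_
  refine Runs.step 18 k (by simp [Instr.step, Operand.val, BinOp.eval, reg_setReg, g5, hF]) ?_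
  refine Runs.step 15 h (by simp [Instr.step, Operand.val, BinOp.eval, reg_setReg, g8, m₁₃]) ?_
  refine (scanLoop_runs (f := f) (S := S) (o := o) (e := e) (j := j) (h := h) (δ := δ) hf k
    (RB + K * f) rec _ ?_ hk (by rw [add_assoc, hKf]; exact hpos) hcand ?_ ?_ ?_ ?_ ?_ ?_ ?_
    ?_).mono le_rfl ?_
  · intro i hi
    rw [← hrec i hi]
    congr 1
    ring
  any_goals simp [reg_setReg, g4, g5]
  intro s' hfr hle hδ hgood
  refine ⟨⟨?_, ?_, ?_, ?_, ?_, ?_, ?_⟩, ?_, ?_, hle, hδ, hgood⟩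
  all_goals rw [hfr _ (by norm_num) (by norm_num)]
  all_goals simp [g1, g4, g5, g6, g7, g8, g9]
  ring

/-- The effect of each pass is assumed, and `hit` marks the entries that attain `δ`. The offset `i₀`
keeps the numbering of entries fixed while the induction removes the first one. -/
lemma entryLoop_runs {w f S TB RB δ τ : ℕ} {x y : List Bool} {hit : ℕ → Prop} (N : ℕ) :
    ∀ (i₀ p : ℕ) (s : State), Params w f S TB RB s → s.reg 2 = N → s.reg 3 = p →
      (∀ i < N, ∀ s : State, Params w f S TB RB s → s.reg 2 = N - i → s.reg 3 = p + i * (5 * w) →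
        Runs w x y entryBody s τ fun s' => Params w f S TB RB s' ∧ s'.reg 2 = N - i - 1 ∧
          s'.reg 3 = p + i * (5 * w) + 5 * w ∧ s'.reg 0 ≤ s.reg 0 ∧
          (δ ≤ s.reg 0 → δ ≤ s'.reg 0) ∧ (hit (i₀ + i) → s'.reg 0 ≤ δ)) →
      Runs w x y entryLoop s (N * (τ + 1) + 1) fun s' => s'.reg 1 = 0 ∧ s'.reg 0 ≤ s.reg 0 ∧
        (δ ≤ s.reg 0 → δ ≤ s'.reg 0) ∧ ∀ i < N, hit (i₀ + i) → s'.reg 0 ≤ δ := by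
  induction N with
  | zero =>
    intro i₀ p s hs h2 _ _
    refine (Runs.while_false ?_ ⟨hs.1, le_rfl, id, fun i hi => absurd hi (by omega)⟩).mono
      (by omega) fun _ h => h
    simp [Cmp.holds, Operand.val, h2]
  | succ N ih =>
    intro i₀ p s hs h2 h3 hbody
    refine (Runs.while_true (t := τ) (t' := N * (τ + 1) + 1) ?_ ?_).mono (by ring_nf; omega)
      fun _ h => h
    · simp [Cmp.holds, Operand.val, h2]
    refine (hbody 0 (by omega) s hs h2 (by rw [h3]; ring)).mono le_rfl ?_
    rintro s₁ ⟨hs₁, h2₁, h3₁, hle₁, hδ₁, hh₁⟩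
    refine (ih (i₀ + 1) (p + 5 * w) s₁ hs₁ (by omega) (by rw [h3₁]; ring) ?_).mono le_rfl ?_
    · intro i hi s₂ hs₂ h2₂ h3₂
      refine (hbody (i + 1) (by omega) s₂ hs₂ (by omega) (by rw [h3₂]; ring)).mono le_rfl ?_
      rintro s₃ ⟨a₁, a₂, a₃, a₄, a₅, a₆⟩
      refine ⟨a₁, by omega, by rw [a₃]; ring, a₄, a₅, fun h => a₆ ?_⟩
      rwa [show i₀ + (i + 1) = i₀ + 1 + i by ring]
    · rintro s₂ ⟨a₁, a₂, a₃, a₄⟩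
      refine ⟨a₁, a₂.trans hle₁, a₃ ∘ hδ₁, fun i hi h => ?_⟩
      cases i with
      | zero => exact a₂.trans (hh₁ h)
      | succ i => exact a₄ i (by omega) (by rwa [show i₀ + 1 + i = i₀ + (i + 1) by ring])

open Operand in
/-- The decoder: compares the components, reads the header, and processes the ball entries. -/
def decoder : Prog :=
  .seq (.instr (.read 2 false (lit 0) wordSize)) <|
  .seq (.instr (.read 3 true (lit 0) wordSize)) <|
  .ite .ne (reg 2) (reg 3) (.instr (.mov 1 (lit 1))) <|
  .seq (.instr (.mov 10 wordSize)) <|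
  .seq (.instr (.read 2 true (reg 10) wordSize)) <|
  .seq (.instr (.op .add 10 (reg 10) wordSize)) <|
  .seq (.instr (.read 3 true (reg 10) wordSize)) <|
  .seq (.instr (.op .add 10 (reg 10) wordSize)) <|
  .seq (.instr (.read 4 true (reg 10) wordSize)) <|
  .seq (.instr (.op .add 10 (reg 10) wordSize)) <|
  .seq (.instr (.read 5 true (reg 10) wordSize)) <|
  .seq (.instr (.op .add 10 (reg 10) wordSize)) <|
  .seq (.instr (.read 6 true (reg 10) wordSize)) <|
  .seq (.instr (.op .add 10 (reg 10) wordSize)) <|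
  .seq (.instr (.read 7 false (reg 10) wordSize)) <|
  .seq (.instr (.op .shr 8 wordSize (lit 1))) <|
  .seq (.instr (.op .shl 9 (lit 1) (reg 8))) <|
  .seq (.instr (.op .sub 0 (reg 0) (lit 1)))
  entryLoop

lemma decoder_top {w : ℕ} {x y : List Bool} (hw : 1 ≤ w)
    (h : readBits x 0 w ≠ readBits y 0 w) :
    Runs w x y decoder State.zero 5 fun s => s.output = ⊤ := by
  have h1w : 1 % 2 ^ w = 1 := Nat.mod_eq_of_lt (Nat.one_lt_two_pow (by omega))
  refine (Runs.step (t := 3) 2 (readBits x 0 w) (by simp [Instr.step, Operand.val]) ?_).mono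
    (by omega) fun _ h => h
  refine Runs.step (t := 2) 3 (readBits y 0 w) (by simp [Instr.step, Operand.val]) ?_
  refine Runs.ite_true (by simpa [Cmp.holds, Operand.val, reg_setReg] using h) ?_
  refine Runs.instr 1 1 (by simp [Instr.step, Operand.val, h1w]) ?_
  simp [State.output, reg_setReg]

lemma decoder_runs {w f S TB RB BP N δ τ : ℕ} {x y : List Bool} {hit : ℕ → Prop} (hw : 2 ≤ w)
    (h7 : 7 * w < 2 ^ w) (h : readBits x 0 w = readBits y 0 w) (r₁ : readBits y w w = N)
    (r₂ : readBits y (w + w) w = BP) (r₃ : readBits y (w + w + w) w = f)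
    (r₄ : readBits y (w + w + w + w) w = S) (r₅ : readBits y (w + w + w + w + w) w = TB)
    (r₆ : readBits x (w + w + w + w + w + w) w = RB) (hδ : δ < 2 ^ w)
    (hbody : ∀ i < N, ∀ s : State, Params w f S TB RB s → s.reg 2 = N - i →
      s.reg 3 = BP + i * (5 * w) →
      Runs w x y entryBody s τ fun s' => Params w f S TB RB s' ∧ s'.reg 2 = N - i - 1 ∧
        s'.reg 3 = BP + i * (5 * w) + 5 * w ∧ s'.reg 0 ≤ s.reg 0 ∧
        (δ ≤ s.reg 0 → δ ≤ s'.reg 0) ∧ (hit i → s'.reg 0 ≤ δ))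
    (hhit : ∃ i < N, hit i) :
    Runs w x y decoder State.zero (N * (τ + 1) + 19) fun s => s.output = δ := by
  have h1w : 1 % 2 ^ w = 1 := Nat.mod_eq_of_lt (Nat.one_lt_two_pow (by omega))
  have m₁ : (w + w) % 2 ^ w = w + w := Nat.mod_eq_of_lt (by omega)
  have m₂ : (w + w + w) % 2 ^ w = w + w + w := Nat.mod_eq_of_lt (by omega)
  have m₃ : (w + w + w + w) % 2 ^ w = w + w + w + w := Nat.mod_eq_of_lt (by omega)
  have m₄ : (w + w + w + w + w) % 2 ^ w = w + w + w + w + w := Nat.mod_eq_of_lt (by omega)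
  have m₅ : (w + w + w + w + w + w) % 2 ^ w = w + w + w + w + w + w := Nat.mod_eq_of_lt (by omega)
  have m₆ : 2 ^ (w / 2) % 2 ^ w = 2 ^ (w / 2) :=
    Nat.mod_eq_of_lt (Nat.pow_lt_pow_right (by norm_num) (by omega))
  have m₇ : (2 ^ w - 1) % 2 ^ w = 2 ^ w - 1 := Nat.mod_eq_of_lt (by omega)
  refine Runs.step 2 (readBits x 0 w) (by simp [Instr.step, Operand.val]) ?_
  refine Runs.step 3 (readBits y 0 w) (by simp [Instr.step, Operand.val]) ?_
  refine Runs.ite_false (by simpa [Cmp.holds, Operand.val, reg_setReg] using h) ?_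
  refine Runs.step 10 w (by simp [Instr.step, Operand.val]) ?_
  refine Runs.step 2 N (by simp [Instr.step, Operand.val, reg_setReg, r₁]) ?_
  refine Runs.step 10 (w + w) (by simp [Instr.step, Operand.val, BinOp.eval, reg_setReg, m₁]) ?_
  refine Runs.step 3 BP (by simp [Instr.step, Operand.val, reg_setReg, r₂]) ?_
  refine Runs.step 10 (w + w + w) (by simp [Instr.step, Operand.val, BinOp.eval, reg_setReg, m₂]) ?_
  refine Runs.step 4 f (by simp [Instr.step, Operand.val, reg_setReg, r₃]) ?_
  refine Runs.step 10 (w + w + w + w)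
    (by simp [Instr.step, Operand.val, BinOp.eval, reg_setReg, m₃]) ?_
  refine Runs.step 5 S (by simp [Instr.step, Operand.val, reg_setReg, r₄]) ?_
  refine Runs.step 10 (w + w + w + w + w)
    (by simp [Instr.step, Operand.val, BinOp.eval, reg_setReg, m₄]) ?_
  refine Runs.step 6 TB (by simp [Instr.step, Operand.val, reg_setReg, r₅]) ?_
  refine Runs.step 10 (w + w + w + w + w + w)
    (by simp [Instr.step, Operand.val, BinOp.eval, reg_setReg, m₅]) ?_
  refine Runs.step 7 RB (by simp [Instr.step, Operand.val, reg_setReg, r₆]) ?_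
  refine Runs.step 8 (w / 2) (by simp [Instr.step, Operand.val, BinOp.eval, h1w]) ?_
  refine Runs.step 9 (2 ^ (w / 2))
    (by simp [Instr.step, Operand.val, BinOp.eval, reg_setReg, h1w, m₆]) ?_
  -- Subtracting 1 from 0 wraps around to the largest word, the initial value of the minimum.
  refine Runs.step 0 (2 ^ w - 1)
    (by simp [Instr.step, Operand.val, BinOp.eval, reg_setReg, State.zero, h1w, m₇]) ?_
  refine (entryLoop_runs (f := f) (S := S) (TB := TB) (RB := RB) (δ := δ) (τ := τ) (hit := hit) N 0
    BP _ ?_ ?_ ?_ ?_).mono le_rfl ?_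
  · simp [Params, reg_setReg, State.zero]
  · simp [reg_setReg]
  · simp [reg_setReg]
  · simpa using hbody
  · rintro s ⟨h₁, -, h₃, h₄⟩
    obtain ⟨i, hi, hhi⟩ := hhit
    have h₅ := h₃ (by simp [reg_setReg]; omega)
    have h₆ := h₄ i hi (by simpa using hhi)
    simp [State.output, h₁, le_antisymm h₆ h₅]

end WordRAM

/-! ### Decoding hub labels -/

/-- The conditions on the parameters of hub labels under which no overflow occurs. -/
structure LabelParams (w D g M nb n : ℕ) : Prop where
  two_le_w : 2 ≤ w
  seven_mul_lt : 7 * w < 2 ^ w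
  one_le_D : 1 ≤ D
  D_le : D ≤ n
  g_pos : 0 < g
  summaries_le : g * (2 * halfWidth D) ≤ w
  div_lt : M / g < nb
  tour_lt : 2 * n < M * D
  table_lt : g * 2 ^ (halfWidth D + 1) < 2 ^ (w / 2)
  values_lt : 2 * n + 2 * (M * D) < 2 ^ (w / 2)

section Decode

variable {w D g M nb n : ℕ} {cu cv : ℕ} {h h' : ℕ → ℕ} {A A' : Finset ℕ} {B B' : List (ℕ × ℕ)}

lemma two_pow_half_mul_self_le (w : ℕ) :
    2 ^ (w / 2) * 2 ^ (w / 2) ≤ 2 ^ w := by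
  rw [← pow_add]
  exact Nat.pow_le_pow_right (by norm_num) (by omega)

lemma LabelParams.two_mul_two_pow_half (hp : LabelParams w D g M nb n) :
    2 * 2 ^ (w / 2) ≤ 2 ^ w := by
  rw [← pow_succ']
  exact Nat.pow_le_pow_right (by norm_num) (by have := hp.two_le_w; omega)

/-- Each of the g repacked summaries is at most 2^(`halfWidth D` + 1) · 2^(w/2), so `table_lt` keeps
the sum within one word. -/
lemma LabelParams.digitSum_lt (hp : LabelParams w D g M nb n) (z : ℕ) :
    digitSum (unpackSummary D (w / 2)) (2 ^ (2 * halfWidth D)) g z < 2 ^ w := by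
  have key : ∀ v < 2 ^ (2 * halfWidth D), unpackSummary D (w / 2) v ≤
      2 ^ (halfWidth D + 1) * 2 ^ (w / 2) := by
    intro v hv
    rw [two_mul, pow_add] at hv
    have h₁ := Nat.mod_lt v (Nat.two_pow_pos (halfWidth D))
    have h₂ : v / 2 ^ halfWidth D < 2 ^ halfWidth D := Nat.div_lt_of_lt_mul hv
    have h₃ := Nat.one_le_two_pow (n := w / 2)
    have h₄ := Nat.mul_le_mul_left (2 ^ (w / 2)) h₂.le
    have h₅ := Nat.le_mul_of_pos_right (2 ^ halfWidth D) (show 0 < 2 ^ (w / 2) by omega)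
    rw [unpackSummary, pow_succ, mul_right_comm, mul_two]
    rw [mul_comm] at h₄
    rw [mul_comm (2 ^ (w / 2))]
    rw [mul_comm (2 ^ (w / 2))] at h₄
    omega
  refine (digitSum_le (by positivity) key g z).trans_lt ?_
  refine lt_of_lt_of_le ?_ (two_pow_half_mul_self_le w)
  rw [← mul_assoc]
  exact Nat.mul_lt_mul_of_pos_right hp.table_lt (by positivity)

lemma LabelParams.h_lt (hp : LabelParams w D g M nb n)
    (hh : ∀ j, h j ≤ h (j + 1) ∧ h (j + 1) ≤ h j + 2) (h0 : h 0 ≤ n) {j : ℕ} (hj : j ≤ M * D) :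
    h j + n < 2 ^ (w / 2) := by
  have h₁ := monotone_and_le_of_increments hh 0 j
  have h₂ := hp.values_lt
  rw [zero_add] at h₁
  omega

lemma LabelParams.packedPrefix_lt (hp : LabelParams w D g M nb n)
    (hh : ∀ j, h j ≤ h (j + 1) ∧ h (j + 1) ≤ h j + 2) (h0 : h 0 ≤ n) (hA : A.card < 2 ^ (w / 2))
    {q : ℕ} (hq : q < M) : packedPrefix D (w / 2) h A q < 2 ^ w := by
  have h₁ := hp.h_lt hh h0 (Nat.mul_le_mul_right D hq.le)
  have h₂ := (hubRank_le_card (D := D) (h := h) (A := A) q).trans_lt hA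
  refine lt_of_lt_of_le ?_ (two_pow_half_mul_self_le w)
  have h₃ : h (q * D) + 1 ≤ 2 ^ (w / 2) := by omega
  have h₄ := Nat.mul_le_mul_left (2 ^ (w / 2)) h₃
  rw [mul_add] at h₄
  rw [packedPrefix]
  omega

lemma labelBases_eq (w D g nb : ℕ) :
    7 * w + 2 ^ (g * (2 * halfWidth D)) * w = blockBase w D g ∧
      blockBase w D g + nb * blockLength w D g = ballBase w D g nb := ⟨rfl, rfl⟩

/-- The effect of one pass through the loop of the decoder on hub labels. -/
lemma entryBody_hubLabel (hp : LabelParams w D g M nb n)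
    (hh : ∀ j, h j ≤ h (j + 1) ∧ h (j + 1) ≤ h j + 2) (h0 : h 0 ≤ n) (hA : A.card < 2 ^ (w / 2))
    (hB' : ∀ a ∈ B', a.1 ≤ 2 * n ∧ a.2 ≤ n)
    (hx : (hubLabel w D g M nb cu h A B).length < 2 ^ w)
    (hy : (hubLabel w D g M nb cv h' A' B').length < 2 ^ w) {δ i : ℕ} (hi : i < B'.length)
    (hδ : ∀ a ∈ B', a.1 ∈ A → δ + a.1 ≤ h a.1 + a.2) {s : State}
    (hs : Params w (2 * halfWidth D) (2 ^ halfWidth D) (7 * w)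
      (ballBase w D g nb + B.length * (5 * w)) s)
    (h2 : s.reg 2 = B'.length - i) (h3 : s.reg 3 = ballBase w D g nb + i * (5 * w)) :
    Runs w (hubLabel w D g M nb cu h A B) (hubLabel w D g M nb cv h' A' B') entryBody s
      (12 * D + 26) fun s' =>
      Params w (2 * halfWidth D) (2 ^ halfWidth D) (7 * w)
        (ballBase w D g nb + B.length * (5 * w)) s' ∧
      s'.reg 2 = B'.length - i - 1 ∧ s'.reg 3 = ballBase w D g nb + i * (5 * w) + 5 * w ∧
      s'.reg 0 ≤ s.reg 0 ∧ (δ ≤ s.reg 0 → δ ≤ s'.reg 0) ∧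
      (B'[i].1 ∈ A ∧ h B'[i].1 + B'[i].2 = δ + B'[i].1 → s'.reg 0 ≤ δ) := by
  obtain ⟨hj, he⟩ := hB' _ (List.getElem_mem hi)
  have hδi := hδ _ (List.getElem_mem hi)
  have rb := fun (t : ℕ) (ht : t < 5) => readBits_ball (w := w) (D := D) (g := g) (M := M)
    (nb := nb) (comp := cv) (h := h') (A := A') hi ht
  generalize B'[i] = a at hj he hδi rb
  obtain ⟨j, e⟩ := a
  simp only [ballEntry] at hj he hδi rb ⊢
  have hww := hp.two_le_w
  have hD := hp.one_le_D
  have hDn := hp.D_le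
  have hsum := hp.summaries_le
  have hS := two_mul_lt_two_pow_halfWidth D
  have hvals := hp.values_lt
  have hhalf := hp.two_mul_two_pow_half
  have hw2 : w < 2 ^ w := Nat.lt_two_pow_self
  have hg := hp.g_pos
  have hf : 2 * halfWidth D ≤ w := (Nat.le_mul_of_pos_left _ hg).trans hsum
  have hq : j / D < M := by
    rw [Nat.div_lt_iff_lt_mul (by omega)]
    have := hp.tour_lt
    omega
  have hqb : j / D / g < nb := (Nat.div_le_div_right hq.le).trans_lt hp.div_lt
  have hjdm : j / D * D + j % D = j := by rw [mul_comm]; exact Nat.div_add_mod j D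
  have hjD : j % D < D := Nat.mod_lt _ (by omega)
  obtain ⟨P, z, t, e₁, e₂, e₃, e₄, hz, hPt⟩ := subblock_lookup (w := w) (D := D) (g := g) (M := M)
    (nb := nb) (comp := cu) (h := h) (A := A) (ball := B) hh hg hqb
    (fun q hq => hp.packedPrefix_lt hh h0 hA hq) hq hp.digitSum_lt
  set q := j / D with hqdef
  rw [length_hubLabel] at hx hy
  have hr : q % g < g := Nat.mod_lt _ hg
  have hl : q % g * (2 * halfWidth D) ≤ w := (Nat.mul_le_mul_right _ hr.le).trans hsum
  have hbl : q / g * blockLength w D g + (w + q % g * (2 * halfWidth D)) ≤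
      nb * blockLength w D g := by
    have h₁ := Nat.mul_le_mul_right (blockLength w D g) hqb
    rw [Nat.succ_mul] at h₁
    have h₂ := Nat.mul_le_mul_right (2 * halfWidth D) hr.le
    have h₃ : blockLength w D g = w + g * (2 * halfWidth D) := rfl
    omega
  have hbase := labelBases_eq w D g nb
  have hzw : z * w ≤ 2 ^ (g * (2 * halfWidth D)) * w := Nat.mul_le_mul_right _ hz.le
  have hiB : i * (5 * w) + 5 * w ≤ B'.length * (5 * w) := by
    rw [← Nat.succ_mul]; exact Nat.mul_le_mul_right _ hi
  have hBle : B'.length ≤ B'.length * (5 * w) := Nat.le_mul_of_pos_right _ (by omega)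
  have hrank : hubRank D h A q + (subRecords D h A q).length ≤ hubRank D h A M := by
    rw [hubRank, ← Finset.sum_range_succ]
    exact Finset.sum_le_sum_of_subset (Finset.range_subset_range.2 hq)
  have hrec : ∀ i' (hi' : i' < (subRecords D h A q).length), ∃ o < D, q * D + o ∈ A ∧
      (subRecords D h A q)[i'] = o + 2 ^ halfWidth D * (h (q * D + o) - h (q * D)) := by
    intro i' hi'
    have hmem := List.getElem_mem hi'
    obtain ⟨o, ho, hoe⟩ := List.mem_map.1 hmem
    simp only [List.mem_filter, List.mem_range, decide_eq_true_eq] at ho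
    exact ⟨o, ho.1, ho.2, hoe.symm⟩
  -- Within the subblock an offset determines the position. A matching record therefore belongs to
  -- `j` itself, and its increment restores `h j`.
  have hmatch : ∀ i', i' < (subRecords D h A q).length →
      (subRecords D h A q).getD i' 0 % 2 ^ halfWidth D = j % D →
      j ∈ A ∧ (subRecords D h A q).getD i' 0 / 2 ^ halfWidth D + h (q * D) + e = h j + e := by
    intro i' hi' hm
    obtain ⟨o, ho, hoA, hoe⟩ := hrec i' hi'
    rw [List.getD_eq_getElem _ _ hi', hoe] at hm ⊢
    rw [Nat.add_mul_mod_self_left, Nat.mod_eq_of_lt (by omega)] at hm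
    subst hm
    rw [hjdm] at hoA ⊢
    refine ⟨hoA, ?_⟩
    rw [Nat.add_mul_div_left _ _ (by positivity), Nat.div_eq_of_lt (by omega)]
    have := (monotone_and_le_of_increments hh (q * D) (j % D)).1
    rw [hjdm] at this
    omega
  have hhj : h j + n < 2 ^ (w / 2) := hp.h_lt hh h0 (by have := hp.tour_lt; omega)
  refine (entryBody_runs (N := B'.length - i - 1) (p := ballBase w D g nb + i * (5 * w))
    (A := blockBase w D g + q / g * blockLength w D g) (l := q % g * (2 * halfWidth D))
    (o := j % D) (e := e) (j := j) (P := P) (z := z) (t := t) (F := summary D h A q)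
    (K := hubRank D h A q) (k := (subRecords D h A q).length) (h := h (q * D)) (δ := δ)
    (rec := fun i => (subRecords D h A q).getD i 0) hs (by omega) h3 (by omega) hf hl (by omega)
    (by omega) ?_ ?_ ?_ ?_ ?_ e₁ e₂ e₄ e₃ (by omega) (by omega) hPt ?_ ?_
    (summary_parts hh _).2.1 ?_ ?_ ?_ ?_).mono ?_ ?_
  · simpa using rb 0 (by omega) (by simp [← hqdef]; omega)
  · simpa using rb 1 (by omega) (by simp [← hqdef]; omega)
  · have := rb 2 (by omega) (by simp; omega)
    rw [add_assoc (ballBase w D g nb + i * (5 * w)), ← two_mul]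
    simpa using this
  · have := rb 3 (by omega) (by simp; omega)
    rw [show ballBase w D g nb + i * (5 * w) + w + w + w =
      ballBase w D g nb + i * (5 * w) + 3 * w by ring]
    simpa using this
  · have := rb 4 (by omega) (by simp; omega)
    rw [show ballBase w D g nb + i * (5 * w) + w + w + w + w =
      ballBase w D g nb + i * (5 * w) + 4 * w by ring]
    simpa using this
  · rw [hPt]
    exact hp.packedPrefix_lt hh h0 hA hq
  · exact (hubRank_le_card _).trans_lt hA
  · have := length_subRecords_le (D := D) (h := h) (A := A) q
    omega
  · have := Nat.mul_le_mul_right (2 * halfWidth D) hrank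
    omega
  · intro i' hi'
    rw [readBits_record hh hq hi', List.getD_eq_getElem]
  · intro i' hi' hm
    obtain ⟨h₁, h₂⟩ := hmatch i' hi' hm
    rw [h₂]
    exact ⟨hδi h₁, by omega⟩
  · have := length_subRecords_le (D := D) (h := h) (A := A) q
    omega
  · rintro s' ⟨a₁, a₂, a₃, a₄, a₅, a₆⟩
    refine ⟨a₁, a₂, a₃, a₄, a₅, ?_⟩
    rintro ⟨hjA, hje⟩
    have hmem : j % D + 2 ^ halfWidth D * (h (q * D + j % D) - h (q * D)) ∈
        subRecords D h A q := by
      refine List.mem_map.2 ⟨j % D, ?_, rfl⟩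
      simpa [hjdm, hjD] using hjA
    obtain ⟨i', hi', hie⟩ := List.getElem_of_mem hmem
    have hm : (subRecords D h A q).getD i' 0 % 2 ^ halfWidth D = j % D := by
      rw [List.getD_eq_getElem _ _ hi', hie, Nat.add_mul_mod_self_left, Nat.mod_eq_of_lt (by omega)]
    have h₁ := a₆ i' hi' hm
    rw [(hmatch i' hi' hm).2] at h₁
    omega

lemma hubLabel_decodes_top (hp : LabelParams w D g M nb n) (hcu : cu ≤ n) (hcv : cv ≤ n)
    (hne : cu ≠ cv) :
    Runs w (hubLabel w D g M nb cu h A B) (hubLabel w D g M nb cv h' A' B') decoder State.zero 5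
      fun s => s.output = ⊤ := by
  have hvals := hp.values_lt
  have hhalf := hp.two_mul_two_pow_half
  refine decoder_top (by have := hp.two_le_w; omega) ?_
  have e₁ := readBits_header (w := w) (D := D) (g := g) (M := M) (nb := nb) (comp := cu) (h := h)
    (A := A) (ball := B) (i := 0) (by omega) (by simp [labelHeader]; omega)
  have e₂ := readBits_header (w := w) (D := D) (g := g) (M := M) (nb := nb) (comp := cv) (h := h')
    (A := A') (ball := B') (i := 0) (by omega) (by simp [labelHeader]; omega)
  rw [zero_mul] at e₁ e₂
  rw [e₁, e₂]
  exact hne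

lemma hubLabel_decodes (hp : LabelParams w D g M nb n) (hcu : cu ≤ n)
    (hh : ∀ j, h j ≤ h (j + 1) ∧ h (j + 1) ≤ h j + 2) (h0 : h 0 ≤ n) (hA : A.card < 2 ^ (w / 2))
    (hB' : ∀ a ∈ B', a.1 ≤ 2 * n ∧ a.2 ≤ n)
    (hx : (hubLabel w D g M nb cu h A B).length < 2 ^ w)
    (hy : (hubLabel w D g M nb cu h' A' B').length < 2 ^ w) {δ : ℕ} (hδn : δ ≤ n)
    (hδ : ∀ a ∈ B', a.1 ∈ A → δ + a.1 ≤ h a.1 + a.2)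
    (hex : ∃ a ∈ B', a.1 ∈ A ∧ h a.1 + a.2 = δ + a.1) :
    Runs w (hubLabel w D g M nb cu h A B) (hubLabel w D g M nb cu h' A' B') decoder State.zero
      (B'.length * (12 * D + 27) + 19) fun s => s.output = δ := by
  have hvals := hp.values_lt
  have hhalf := hp.two_mul_two_pow_half
  have hww := hp.two_le_w
  have hw2 : w < 2 ^ w := Nat.lt_two_pow_self
  have hf : 2 * halfWidth D ≤ w := (Nat.le_mul_of_pos_left _ hp.g_pos).trans hp.summaries_le
  have hS : 2 ^ halfWidth D < 2 ^ w :=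
    Nat.pow_lt_pow_right (by norm_num) (by have : 2 ≤ halfWidth D := by simp [halfWidth]
                                           omega)
  have hlx := hx
  have hly := hy
  rw [length_hubLabel] at hlx hly
  have hB1 : B'.length ≤ B'.length * (5 * w) := Nat.le_mul_of_pos_right _ (by omega)
  have rx := fun (i : ℕ) (hi : i < 7) => readBits_header (w := w) (D := D) (g := g) (M := M)
    (nb := nb) (comp := cu) (h := h) (A := A) (ball := B) hi
  have ry := fun (i : ℕ) (hi : i < 7) => readBits_header (w := w) (D := D) (g := g) (M := M)
    (nb := nb) (comp := cu) (h := h') (A := A') (ball := B') hi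
  simp only [labelHeader] at rx ry
  have h7 := hp.seven_mul_lt
  refine decoder_runs (BP := ballBase w D g nb) (f := 2 * halfWidth D) (S := 2 ^ halfWidth D)
    (TB := 7 * w) (RB := ballBase w D g nb + B.length * (5 * w)) (δ := δ)
    (hit := fun i => ∃ hi : i < B'.length, B'[i].1 ∈ A ∧ h B'[i].1 + B'[i].2 = δ + B'[i].1)
    hww h7 ?_ (N := B'.length) ?_ ?_ ?_ ?_ ?_ ?_ (by omega) ?_ ?_
  · have e₁ := rx 0 (by omega) (by simp; omega)
    have e₂ := ry 0 (by omega) (by simp; omega)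
    rw [zero_mul] at e₁ e₂
    rw [e₁, e₂]
    rfl
  · simpa using ry 1 (by omega) (by simp; omega)
  · rw [show w + w = 2 * w by ring]
    exact ry 2 (by omega) (by simp; omega)
  · rw [show w + w + w = 3 * w by ring]
    exact ry 3 (by omega) (by simp; omega)
  · rw [show w + w + w + w = 4 * w by ring]
    exact ry 4 (by omega) (by simp only [List.getElem_cons_succ, List.getElem_cons_zero]; omega)
  · rw [show w + w + w + w + w = 5 * w by ring]
    exact ry 5 (by omega) (by simp; omega)
  · rw [show w + w + w + w + w + w = 6 * w by ring]
    exact rx 6 (by omega) (by simp; omega)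
  · intro i hi s hs h2 h3
    refine (entryBody_hubLabel hp hh h0 hA hB' hx hy hi hδ hs h2 h3).mono le_rfl ?_
    rintro s' ⟨a₁, a₂, a₃, a₄, a₅, a₆⟩
    exact ⟨a₁, a₂, a₃, a₄, a₅, fun ⟨_, h⟩ => a₆ h⟩
  · obtain ⟨a, ha, h₁, h₂⟩ := hex
    obtain ⟨i, hi, rfl⟩ := List.getElem_of_mem ha
    exact ⟨i, hi, hi, h₁, h₂⟩

end Decode

/-! ### Size estimates -/

section Size

variable {n D : ℕ}

/-- Number of summaries in a block. -/
def blockSize (n D : ℕ) : ℕ := (Nat.log 2 n + 1) / (8 * (2 * halfWidth D)) + 1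

/-- Number of subblocks. -/
def numSubblocks (n D : ℕ) : ℕ := 2 * n / D + 1

/-- Number of blocks. -/
def numBlocks (n D : ℕ) : ℕ := numSubblocks n D / blockSize n D + 1

lemma two_pow_halfWidth_le (hD : 1 ≤ D) : 2 ^ halfWidth D ≤ 4 * D := by
  have := Nat.pow_log_le_self 2 (show D ≠ 0 by omega)
  rw [halfWidth, pow_add]
  omega

lemma halfWidth_le (D : ℕ) : halfWidth D ≤ D + 2 := by
  have := Nat.log_le_self 2 D
  rw [halfWidth]
  omega

/-- The summaries of a block take about L/8 bits, L = ⌊log₂ n⌋ + 1. This is few enough for the table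
to have about n^(1/8) entries up to a factor polynomial in D, and enough to spread one prefix word
over the block. -/
lemma blockSize_mul_le (n D : ℕ) :
    blockSize n D * (2 * halfWidth D) ≤ (Nat.log 2 n + 1) / 8 + 2 * halfWidth D := by
  rw [blockSize, add_mul, one_mul, ← Nat.div_div_eq_div_mul]
  exact Nat.add_le_add_right (Nat.div_mul_le_self _ _) _

lemma lt_blockSize_mul (n D : ℕ) :
    Nat.log 2 n + 1 < blockSize n D * (8 * (2 * halfWidth D)) := by
  rw [blockSize, mul_comm]
  exact Nat.lt_mul_div_succ _ (by simp [halfWidth])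

lemma numSubblocks_mul (hD : 1 ≤ D) :
    2 * n < numSubblocks n D * D ∧ numSubblocks n D * D ≤ 2 * n + D := by
  rw [numSubblocks]
  constructor
  · rw [mul_comm (_ + 1)]
    exact Nat.lt_mul_div_succ _ hD
  · rw [add_mul, one_mul]
    exact Nat.add_le_add_right (Nat.div_mul_le_self _ _) _

/-- With w = 32L a half word has 16L bits, while all packed quantities are below a constant times n
or L², hence below a small power of 2^L. -/
lemma labelParams (hn : 1 ≤ n) (hD : 1 ≤ D) (hDL : D ≤ Nat.log 2 n + 1) :
    LabelParams (32 * (Nat.log 2 n + 1)) D (blockSize n D) (numSubblocks n D) (numBlocks n D) n := by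
  have hLn := Nat.log_lt_self 2 (show n ≠ 0 by omega)
  have hnL : n < 2 ^ (Nat.log 2 n + 1) := Nat.lt_pow_succ_log_self (by norm_num) n
  have hb := blockSize_mul_le n D
  have hhw := halfWidth_le D
  have hpow := two_pow_halfWidth_le hD
  have hM := numSubblocks_mul (n := n) hD
  have hg : blockSize n D ≤ 2 * (Nat.log 2 n + 1) := by
    rw [blockSize]
    have := Nat.div_le_self (Nat.log 2 n + 1) (8 * (2 * halfWidth D))
    omega
  have h2L : ∀ a b : ℕ, 1 ≤ a → 2 ^ a * (2 ^ b) ^ 2 = 2 ^ (a + 2 * b) := fun a b _ => by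
    rw [← pow_mul, ← pow_add, mul_comm b]
  generalize hL : Nat.log 2 n + 1 = L at *
  have hL2 : L < 2 ^ L := Nat.lt_two_pow_self
  have hhalf : 32 * L / 2 = 16 * L := by omega
  refine ⟨by omega, ?_, hD, by omega, by simp [blockSize], by omega, by simp [numBlocks], hM.1, ?_,
    ?_⟩
  · have : 32 * L - 3 < 2 ^ (32 * L - 3) := Nat.lt_two_pow_self
    have h8 : 2 ^ (32 * L) = 8 * 2 ^ (32 * L - 3) := by
      rw [show 32 * L = 3 + (32 * L - 3) by omega, pow_add]
      norm_num
    omega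
  · rw [hhalf, pow_succ]
    calc _ ≤ (2 * L) * (4 * L * 2) := Nat.mul_le_mul hg (Nat.mul_le_mul_right _ (by omega))
      _ = 2 ^ 4 * L ^ 2 := by ring
      _ < 2 ^ 4 * (2 ^ L) ^ 2 := by gcongr
      _ = 2 ^ (4 + 2 * L) := h2L 4 L (by omega)
      _ ≤ _ := Nat.pow_le_pow_right (by norm_num) (by omega)
  · rw [hhalf]
    calc _ ≤ 2 ^ 3 * n := by omega
      _ < 2 ^ 3 * 2 ^ L := by gcongr
      _ = 2 ^ (3 + L) := by rw [pow_add]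
      _ ≤ _ := Nat.pow_le_pow_right (by norm_num) (by omega)

lemma log_pow_le (hn : 1 ≤ n) :
    (Nat.log 2 n + 1) ^ 4 * 2 ^ ((Nat.log 2 n + 1) / 8) ≤ 131072 * n ∧
      (Nat.log 2 n + 1) ^ 8 ≤ 4294967296 * n := by
  have hpow := Nat.pow_log_le_self 2 (show n ≠ 0 by omega)
  -- With L ≤ 16·2^m, the factors L^4 · 2^(L/8) and L^8 become constants times 2^(6m) and 2^(8m),
  -- both within 2^⌊log₂ n⌋.
  obtain ⟨m, hm⟩ : ∃ m, m = (Nat.log 2 n + 1) / 16 := ⟨_, rfl⟩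
  have h₁ : Nat.log 2 n + 1 ≤ 16 * 2 ^ m := by
    have : m < 2 ^ m := Nat.lt_two_pow_self
    omega
  constructor
  · calc _ ≤ (16 * 2 ^ m) ^ 4 * 2 ^ (2 * m + 1) := by
          gcongr
          · norm_num
          · omega
      _ = 131072 * 2 ^ (6 * m) := by rw [show 6 * m = m * 4 + 2 * m by ring]; ring
      _ ≤ 131072 * 2 ^ Nat.log 2 n := by
          gcongr
          · norm_num
          · omega
      _ ≤ _ := by gcongr
  · calc _ ≤ (16 * 2 ^ m) ^ 8 := by gcongr
      _ = 4294967296 * 2 ^ (8 * m) := by rw [mul_pow, ← pow_mul, mul_comm m]; norm_num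
      _ ≤ 4294967296 * 2 ^ Nat.log 2 n := by
          gcongr
          · norm_num
          · omega
      _ ≤ _ := by gcongr

/-- Multiplying by D avoids division. Summaries, block prefixes and records cost O(log D) bits per
subblock or hub. The header, table and ball contribute only O(n) after multiplication by D ≤ L. -/
lemma length_hubLabel_mul_le (hn : 1 ≤ n) (hD : 1 ≤ D) (hDL : D ≤ Nat.log 2 n + 1) {b comp : ℕ}
    (hb : b ^ 4 ≤ n) {h : ℕ → ℕ} {A : Finset ℕ} {B : List (ℕ × ℕ)} (hA : A.card * D ≤ 2 * n + D)
    (hB : B.length ≤ b) :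
    (hubLabel (32 * (Nat.log 2 n + 1)) D (blockSize n D) (numSubblocks n D) (numBlocks n D) comp h A
      B).length * D ≤ 200000000 * (n * (Nat.log 2 D + 1)) := by
  obtain ⟨hL₁, hL₂⟩ := log_pow_le hn
  have hLn := Nat.log_lt_self 2 (show n ≠ 0 by omega)
  have hbs := blockSize_mul_le n D
  have hbs' := lt_blockSize_mul n D
  have hpow := two_pow_halfWidth_le hD
  have hhw := halfWidth_le D
  have hM := (numSubblocks_mul (n := n) hD).2
  have hrank := hubRank_le_card (D := D) (h := h) (A := A) (numSubblocks n D)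
  have hf : 2 * halfWidth D ≤ 4 * (Nat.log 2 D + 1) := by rw [halfWidth]; omega
  rw [length_hubLabel, ballBase, blockBase, blockLength, numBlocks]
  generalize hL : Nat.log 2 n + 1 = L at *
  generalize Nat.log 2 D + 1 = σ at *
  generalize numSubblocks n D = M at *
  generalize blockSize n D = g at *
  generalize hubRank D h A M = r at *
  generalize hfe : 2 * halfWidth D = f at *
  have hσ : 1 ≤ σ := by
    by_contra hσ
    have : 2 ≤ halfWidth D := by simp [halfWidth]
    omega
  have hL1 : 1 ≤ L := by omega
  have hnσ : n ≤ n * σ := Nat.le_mul_of_pos_right _ hσ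
  have hLL : L * L ≤ 131072 * n := by
    refine le_trans ?_ hL₁
    calc L * L = L ^ 2 := by ring
      _ ≤ L ^ 4 := Nat.pow_le_pow_right hL1 (by norm_num)
      _ ≤ _ := Nat.le_mul_of_pos_right _ (by positivity)
  have hLD : L * D ≤ 131072 * n := (Nat.mul_le_mul_left _ hDL).trans hLL
  have t₂ : 2 ^ (g * f) * (32 * L) * D ≤ 512 * (131072 * n) := by
    calc _ ≤ 2 ^ (L / 8 + f) * (32 * L) * L := by
          gcongr
          norm_num
      _ = (2 ^ halfWidth D) ^ 2 * (32 * L * L * 2 ^ (L / 8)) := by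
          rw [← hfe, pow_add, mul_comm 2 (halfWidth D), pow_mul]; ring
      _ ≤ (4 * L) ^ 2 * (32 * L * L * 2 ^ (L / 8)) := by gcongr; omega
      _ = 512 * (L ^ 4 * 2 ^ (L / 8)) := by ring
      _ ≤ _ := by gcongr
  have t₃ : (M / g + 1) * (32 * L + g * f) * D ≤ 3744 * (n * σ) + 39 * (131072 * n) := by
    have h₁ : 32 * L + g * f ≤ 39 * L := by omega
    have h₂ : M / g * L * D ≤ 96 * (n * σ) := by
      calc _ ≤ M / g * (g * (8 * f)) * D := by gcongr
        _ = M / g * g * D * (8 * f) := by ring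
        _ ≤ M * D * (8 * f) := by gcongr; exact Nat.div_mul_le_self _ _
        _ ≤ (3 * n) * (8 * (4 * σ)) := Nat.mul_le_mul (by omega) (by omega)
        _ = _ := by ring
    calc _ ≤ (M / g + 1) * (39 * L) * D := by gcongr
      _ = 39 * (M / g * L * D) + 39 * (L * D) := by ring
      _ ≤ _ := by omega
  -- The ball takes O(bL) bits, and the factor D adds another L. Since b may not be of order n here,
  -- b^4 ≤ n is used to absorb L².
  have t₄ : B.length * (5 * (32 * L)) * D ≤ 160 * (256 * n) := by
    have h₁ : b * (L * L) ≤ 256 * n := by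
      refine le_of_pow_le_pow_left₀ (n := 4) (by norm_num) (by positivity) ?_
      calc (b * (L * L)) ^ 4 = b ^ 4 * L ^ 8 := by ring
        _ ≤ n * (4294967296 * n) := by gcongr
        _ = 4294967296 * n ^ 2 := by ring
        _ ≤ 4294967296 * n ^ 4 := by
          gcongr
          norm_num
        _ = _ := by ring
    calc _ ≤ b * (5 * (32 * L)) * L := by gcongr
      _ = 160 * (b * (L * L)) := by ring
      _ ≤ _ := by gcongr
  have t₅ : r * f * D ≤ 12 * (n * σ) := by
    calc r * f * D = r * D * f := by ring
      _ ≤ (3 * n) * (4 * σ) :=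
        Nat.mul_le_mul ((Nat.mul_le_mul_right _ hrank).trans (by omega)) hf
      _ = _ := by ring
  have t₁ : 7 * (32 * L) * D = 224 * (L * D) := by ring
  simp only [add_mul _ _ D]
  omega

end Size

/-! ### The labeling scheme -/

section Parameters

lemma one_le_lg (x : ℝ) : 1 ≤ lg x := le_max_left _ _

lemma le_two_rpow_lg {x : ℝ} (hx : 0 ≤ x) : x ≤ 2 ^ lg x := by
  rcases hx.eq_or_lt with rfl | hx
  · positivity
  · rw [← Real.logb_le_iff_le_rpow (by norm_num) hx]
    exact le_max_right _ _

lemma two_rpow_lg_le {x : ℝ} (hx : 0 < x) (h : 1 < lg x) : 2 ^ lg x ≤ x := by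
  rw [← Real.le_logb_iff_rpow_le (by norm_num) hx]
  rcases max_choice 1 (Real.logb 2 x) with h' | h'
  · exact absurd h (by rw [lg, h']; norm_num)
  · rw [lg, h']

/-- The hop bound `D` for the time bound `T`, together with its estimates. -/
lemma exists_hopBound {n : ℕ} {T Δ R : ℝ} (hT : 1 ≤ T) (hTn : T ≤ n) (hΔ : 0 ≤ Δ)
    (hR : R = lg T / lg Δ) : ∃ D : ℕ, 1 ≤ D ∧ D ≤ Nat.log 2 n + 1 ∧
      (D : ℝ) * (((2 * (⌈Δ⌉₊ + 1)) ^ (D - 1) : ℕ) : ℝ) ^ 4 ≤ T ∧ R ≤ 64 * D ∧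
      ((Nat.log 2 D + 1 : ℕ) : ℝ) ≤ 2 * lg R := by
  have hlT := one_le_lg T
  have hlΔ := one_le_lg Δ
  have hlR := one_le_lg R
  have hRpos : 0 < R := by rw [hR]; positivity
  have hRT : R * lg Δ = lg T := by rw [hR]; field_simp
  -- For bounded R the choice D = 1 works: the ball is a single node and labels of O(n) bits are
  -- allowed.
  by_cases hR64 : R < 64
  · refine ⟨1, le_rfl, by omega, by simpa using hT, by push_cast; linarith, ?_⟩
    simp only [Nat.log_one_right, zero_add, Nat.cast_one]
    linarith
  push Not at hR64
  have hD₁ : (⌊R / 32⌋₊ : ℝ) ≤ R / 32 := Nat.floor_le (by positivity)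
  have hD₂ : R / 32 < ⌊R / 32⌋₊ + 1 := Nat.lt_floor_add_one _
  have hDpos : 1 ≤ ⌊R / 32⌋₊ := Nat.le_floor (by push_cast; linarith)
  generalize ⌊R / 32⌋₊ = D at *
  have hlT1 : 1 < lg T := by rw [← hRT]; nlinarith
  have hTpow : (2 : ℝ) ^ lg T ≤ T := two_rpow_lg_le (by linarith) hlT1
  -- The exponent 13 is 1 + 4·3: D costs one factor 2^(D log Δ), and b costs three, since 2(⌈Δ⌉ + 1)
  -- ≤ 2^(3 log Δ), raised to the fourth power. D ≤ R/32 leaves room.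
  have hDlg : 13 * lg Δ * D ≤ lg T := by rw [← hRT]; nlinarith
  have hDle : (D : ℝ) ≤ 2 ^ (D : ℝ) := by
    rw [Real.rpow_natCast]
    exact_mod_cast (Nat.lt_two_pow_self (n := D)).le
  refine ⟨D, hDpos, ?_, ?_, by linarith, ?_⟩
  · have : (2 : ℝ) ^ D ≤ n := by
      refine le_trans ?_ (hTpow.trans hTn)
      rw [← Real.rpow_natCast]
      exact Real.rpow_le_rpow_of_exponent_le (by norm_num) (by nlinarith [Nat.cast_nonneg (α := ℝ) D])
    have h₂ : 2 ^ D ≤ n := by exact_mod_cast this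
    exact (Nat.le_log_of_pow_le (by norm_num) h₂).trans (by omega)
  · have hd : 2 * ((⌈Δ⌉₊ : ℝ) + 1) ≤ 2 ^ (3 * lg Δ) := by
      have h₁ := Nat.ceil_lt_add_one hΔ
      have h₂ := le_two_rpow_lg hΔ
      have h₃ : (2 : ℝ) ≤ 2 ^ lg Δ := by
        conv_lhs => rw [← Real.rpow_one 2]
        exact Real.rpow_le_rpow_of_exponent_le (by norm_num) hlΔ
      have h₄ : (2 : ℝ) ^ (3 * lg Δ) = (2 ^ lg Δ) ^ 3 := by
        rw [mul_comm, Real.rpow_mul (by norm_num)]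
        norm_cast
      rw [h₄]
      nlinarith [mul_self_nonneg ((2 : ℝ) ^ lg Δ - 2)]
    have hb : (((2 * (⌈Δ⌉₊ + 1)) ^ (D - 1) : ℕ) : ℝ) ≤ 2 ^ (3 * lg Δ * D) := by
      push_cast
      calc _ ≤ ((2 : ℝ) ^ (3 * lg Δ)) ^ (D - 1) := by gcongr
        _ ≤ ((2 : ℝ) ^ (3 * lg Δ)) ^ D :=
          pow_le_pow_right₀ (Real.one_le_rpow (by norm_num) (by linarith)) (by omega)
        _ = _ := by rw [← Real.rpow_natCast, ← Real.rpow_mul (by norm_num)]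
    calc _ ≤ (2 : ℝ) ^ (lg Δ * D) * (2 ^ (3 * lg Δ * D)) ^ 4 := by
          gcongr
          refine hDle.trans (Real.rpow_le_rpow_of_exponent_le (by norm_num) ?_)
          nlinarith [Nat.cast_nonneg (α := ℝ) D]
      _ = 2 ^ (13 * lg Δ * D) := by
          rw [← Real.rpow_natCast, ← Real.rpow_mul (by norm_num), ← Real.rpow_add (by norm_num)]
          congr 1
          push_cast
          ring
      _ ≤ 2 ^ lg T := Real.rpow_le_rpow_of_exponent_le (by norm_num) hDlg
      _ ≤ T := hTpow
  · have h₁ : ((Nat.log 2 D : ℕ) : ℝ) ≤ lg R := by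
      refine le_trans ?_ (le_max_right _ _)
      rw [Real.le_logb_iff_rpow_le (by norm_num) hRpos, Real.rpow_natCast]
      have : 2 ^ Nat.log 2 D ≤ D := Nat.pow_log_le_self 2 (by omega)
      have : ((2 ^ Nat.log 2 D : ℕ) : ℝ) ≤ D := by exact_mod_cast this
      push_cast at this
      linarith
    push_cast
    linarith

end Parameters

theorem theorem2 :
    ∃ (C : ℝ) (k : ℕ) (decoder : WordRAM.Prog), 0 < C ∧ 1 ≤ k ∧
      ∀ (n : ℕ) (T Δ R : ℝ), 1 ≤ T → T ≤ n → R = lg T / lg Δ →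
      ∀ (V : Type*) [Fintype V] (G : SimpleGraph V) (c : Sym2 V → ℕ),
        Fintype.card V = n →
        (∀ e ∈ G.edgeSet, c e = 0 ∨ c e = 1) →
        2 * (G.edgeSet.ncard : ℝ) / n ≤ Δ →
        ∃ label : V → List Bool,
          (∀ u : V, ((label u).length : ℝ) ≤ C * (n / R * lg R)) ∧
          ∀ u v : V, ∃ t : ℕ, (t : ℝ) ≤ C * T ∧
            WordRAM.Computes (k * (Nat.log 2 n + 1)) decoder (label u) (label v) t
              (costDist G c u v) := by
  -- The constant is 64 · 200000000 · 2, from R ≤ 64D, the size bound, and ⌊log₂ D⌋ + 1 ≤ 2 log R.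
  -- It also exceeds the time constant 39 + 19.
  refine ⟨25600000000, 32, decoder, by norm_num, by norm_num, ?_⟩
  rintro n T Δ R hT hTn hR V _ G c rfl hc hm
  set n := Fintype.card V with hn
  have hn0 : (0 : ℝ) < n := by linarith
  have hn1 : 1 ≤ n := by exact_mod_cast hn0
  have hΔ : 0 ≤ Δ := le_trans (by positivity) hm
  obtain ⟨D, hD, hDL, hDT, hRD, hDR⟩ := exists_hopBound hT hTn hΔ hR
  have hRpos : 0 < R := by
    have := one_le_lg T
    have := one_le_lg Δ
    rw [hR]
    positivity
  -- The extra 1 makes d positive even when Δ = 0.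
  have hmd : 2 * G.edgeSet.ncard ≤ (⌈Δ⌉₊ + 1) * Fintype.card V := by
    rw [div_le_iff₀ hn0] at hm
    have h₁ := mul_le_mul_of_nonneg_right (Nat.le_ceil Δ) hn0.le
    have : 2 * (G.edgeSet.ncard : ℝ) ≤ ((⌈Δ⌉₊ + 1 : ℕ) : ℝ) * (n : ℝ) := by
      push_cast
      nlinarith
    exact_mod_cast this
  obtain ⟨comp, h, A, ball, hcomp, hinc, h0, hA, hlen, hball, htop, hdec⟩ :=
    exists_hub_structure (G := G) (c := c) hc hD (Nat.le_add_left 1 ⌈Δ⌉₊) hmd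
  generalize hb : (2 * (⌈Δ⌉₊ + 1)) ^ (D - 1) = b at hlen hDT
  have hDreal : (1 : ℝ) ≤ D := by exact_mod_cast hD
  have hb1 : 1 ≤ b := by rw [← hb]; exact Nat.one_le_pow _ _ (by omega)
  have hb1' : (1 : ℝ) ≤ b := by exact_mod_cast hb1
  have hb4 : (b : ℝ) ^ 4 ≤ T := le_trans (le_mul_of_one_le_left (by positivity) hDreal) hDT
  have hbn : b ^ 4 ≤ n := by exact_mod_cast hb4.trans hTn
  have hDb : (D : ℝ) * b ≤ T :=
    le_trans (mul_le_mul_of_nonneg_left (le_self_pow₀ hb1' (by norm_num)) (by positivity)) hDT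
  have hp := labelParams hn1 hD hDL
  let label : V → List Bool := fun u => hubLabel (32 * (Nat.log 2 n + 1)) D (blockSize n D)
    (numSubblocks n D) (numBlocks n D) (comp u) (h u) (A u) (ball u)
  have hsize : ∀ u, (label u).length * D ≤ 200000000 * (n * (Nat.log 2 D + 1)) := fun u =>
    length_hubLabel_mul_le hn1 hD hDL hbn (hA u) (hlen u)
  have hLn := Nat.log_lt_self 2 (show n ≠ 0 by omega)
  have hnL : n < 2 ^ (Nat.log 2 n + 1) := Nat.lt_pow_succ_log_self (by norm_num) n
  have hshort : ∀ u, (label u).length < 2 ^ (32 * (Nat.log 2 n + 1)) := by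
    intro u
    have hlog : Nat.log 2 D + 1 ≤ 2 ^ (Nat.log 2 n + 1) := by
      have := Nat.log_lt_self 2 (show D ≠ 0 by omega)
      have : Nat.log 2 n + 1 < 2 ^ (Nat.log 2 n + 1) := Nat.lt_two_pow_self
      omega
    calc (label u).length ≤ (label u).length * D := Nat.le_mul_of_pos_right _ hD
      _ ≤ _ := hsize u
      _ < 2 ^ 28 * (2 ^ (Nat.log 2 n + 1) * 2 ^ (Nat.log 2 n + 1)) :=
        Nat.mul_lt_mul_of_lt_of_le (by norm_num) (Nat.mul_le_mul hnL.le hlog) (by positivity)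
      _ = 2 ^ (28 + 2 * (Nat.log 2 n + 1)) := by rw [← pow_add, ← pow_add, two_mul]
      _ ≤ _ := Nat.pow_le_pow_right (by norm_num) (by omega)
  have hcard : ∀ u, (A u).card < 2 ^ (32 * (Nat.log 2 n + 1) / 2) := by
    intro u
    have h₁ : (A u).card ≤ (A u).card * D := Nat.le_mul_of_pos_right _ hD
    have h₂ := hA u
    have h₃ := hp.values_lt
    have h₄ := hp.tour_lt
    have h₅ := hp.D_le
    omega
  refine ⟨label, fun u => ?_, fun u v => ?_⟩
  · have h₁ : ((label u).length : ℝ) * D ≤ 200000000 * (n * ((Nat.log 2 D + 1 : ℕ) : ℝ)) := by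
      exact_mod_cast hsize u
    have h₂ : ((label u).length : ℝ) * R ≤ 25600000000 * (n * lg R) := by
      calc ((label u).length : ℝ) * R ≤ (label u).length * (64 * D) := by gcongr
        _ = 64 * ((label u).length * D) := by ring
        _ ≤ 64 * (200000000 * (n * (2 * lg R))) := by
          refine mul_le_mul_of_nonneg_left (h₁.trans ?_) (by norm_num)
          gcongr
        _ = _ := by ring
    rw [← le_div_iff₀ hRpos] at h₂
    calc _ ≤ _ := h₂
      _ = _ := by ring
  · by_cases huv : comp u = comp v
    · obtain ⟨δ, hδn, hδ, hle, hex⟩ := hdec u v huv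
      obtain ⟨s, t, ht, hexec, hout⟩ : Runs (32 * (Nat.log 2 n + 1)) (label u) (label v) decoder
          State.zero ((ball v).length * (12 * D + 27) + 19) fun s => s.output = δ := by
        have hv := hshort v
        simp only [label, ← huv] at hv ⊢
        exact hubLabel_decodes hp (hcomp u) (hinc u) (h0 u) (hcard u) (hball v) (hshort u) hv
          hδn hle hex
      refine ⟨t, ?_, s, hexec, hout.trans hδ.symm⟩
      have h₁ : t ≤ 39 * (D * b) + 19 := by
        refine ht.trans ?_
        have : (ball v).length * (12 * D + 27) ≤ b * (39 * D) :=
          Nat.mul_le_mul (hlen v) (by omega)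
        linarith
      have h₂ : (t : ℝ) ≤ 39 * (D * b) + 19 := by exact_mod_cast h₁
      linarith
    · obtain ⟨s, t, ht, hexec, hout⟩ := hubLabel_decodes_top (h := h u) (h' := h v) (A := A u)
        (A' := A v) (B := ball u) (B' := ball v) hp (hcomp u) (hcomp v) huv
      refine ⟨t, ?_, s, hexec, hout.trans (htop u v huv).symm⟩
      have : (t : ℝ) ≤ 5 := by exact_mod_cast ht
      linarith
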